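/- Let $G$ be a compact Lie group, $K$ a closed connected subgroup, and let $B$ be an invariant inner product on the Lie algebra $\mathfrak g$ of $G$. Let $\mathfrak k$ be the Lie algebra of $K$, let $\mathfrak m=\mathfrak k^{\perp}$, identified with the tangent space of $M=G/K$ at $o=eK$, and let $X_{\mathfrak m}$ denote the orthogonal projection of $X\in\mathfrak g$ to $\mathfrak m$. Give $M$ the standard homogeneous metric induced by $B$, and let $H$ be the torsion three-form of the canonical connection, that is, the homogeneous three-form on $M$ with $H_o(X,Y,Z)=-B([X,Y]_{\mathfrak m},Z)$ for $X,Y,Z\in\mathfrak m$. Suppose that $M$ is a homogeneous QKT space. This means that there are endomorphisms $J_1,J_2,J_3$ of $\mathfrak m$, orthogonal with respect to $B$, with $J_rJ_s=-\delta_{rs}+\sum_t\epsilon_{rst}J_t$, and a linear map $A=(A_1,A_2,A_3):\mathfrak k\to\mathbb R^3$, such that $$[\,\mathrm{ad}_Z|_{\mathfrak m},J_r]=-2\sum_{s,t}\epsilon_{rst}A_s(Z)J_t\quad(Z\in\mathfrak k),$$ $$[J_rX,J_rY]_{\mathfrak m}-[X,Y]_{\mathfrak m}-J_r[J_rX,Y]_{\mathfrak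 m}-J_r[X,J_rY]_{\mathfrak m}=0\quad(X,Y\in\mathfrak m,\ r=1,2,3);$$ thus the $J_r$ span a homogeneous rank-three bundle of endomorphisms of $TM$. Moreover the $\mathfrak{sp}(1)$-part of $\mathfrak k$ is present, i.e. $A$ is surjective (the structure is not merely hyper-complex). By the $\mathfrak{sp}(1)$-part of $\mathfrak k$ we mean the $B$-orthogonal complement of $\ker A$ in $\mathfrak k$. Assume that the exterior derivative $dH$ is of type $(2,2)$ with respect to $J_1$, $J_2$ and $J_3$. If $H\neq0$, then $\dim M=4$. Moreover, if $\dim M\neq4$, then every $Z$ in the $\mathfrak{sp}(1)$-part of $\mathfrak k$ acts on $\mathfrak m$ by $\mathrm{ad}_Z|_{\mathfrak m}=\sum_rA_r(Z)J_r$ (the $\mathfrak{sp}(1)$-part of the isotropy representation is proportional to the $J_r$), and $H=0$. -/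

import Mathlib

open scoped Manifold ContDiff

noncomputable section

/-! ### Differential forms on a manifold without boundary -/

section Forms

variable {m : ℕ} {M : Type*} [TopologicalSpace M] [ChartedSpace (EuclideanSpace ℝ (Fin m)) M]

/-- A (not necessarily smooth) differential `k`-form on `M`. -/
abbrev FormField (m k : ℕ) (M : Type*) [TopologicalSpace M]
    [ChartedSpace (EuclideanSpace ℝ (Fin m)) M] : Type _ :=
  ∀ x : M, TangentSpace (𝓡 m) x [⋀^Fin k]→L[ℝ] ℝ

/-- The expression of a form in the preferred chart at `x`: its pull-back under the inverse of
the chart. -/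
def FormField.inChart {k : ℕ} (α : FormField m k M) (x : M) :
    EuclideanSpace ℝ (Fin m) → EuclideanSpace ℝ (Fin m) [⋀^Fin k]→L[ℝ] ℝ :=
  fun y => (α ((extChartAt (𝓡 m) x).symm y)).compContinuousLinearMap
    (mfderiv (𝓡 m) (𝓡 m) (extChartAt (𝓡 m) x).symm y)

/-- A form is smooth if its expressions in all charts are smooth. -/
def FormField.IsSmooth {k : ℕ} (α : FormField m k M) : Prop :=
  ∀ x : M, ContDiffOn ℝ ∞ (α.inChart x) (extChartAt (𝓡 m) x).target

/-- The exterior derivative of a form, computed at `x` in the preferred chart at `x`. -/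
def FormField.d {k : ℕ} (α : FormField m k M) : FormField m (k + 1) M :=
  fun x => (extDeriv (α.inChart x) (extChartAt (𝓡 m) x x)).compContinuousLinearMap
    (mfderiv (𝓡 m) (𝓡 m) (extChartAt (𝓡 m) x) x)

end Forms

/-- A real alternating form `α` on a real vector space is of type `(p, q)` with respect to the
complex structure `J` if `α ((a + bJ) v₁, …) = (a + bi) ^ p (a - bi) ^ q α (v₁, …)`
for all real `a`, `b`. -/
def IsOfType {V : Type*} [AddCommGroup V] [Module ℝ V] (J : Module.End ℝ V) (p q : ℕ) {k : ℕ}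
    (α : V [⋀^Fin k]→ₗ[ℝ] ℝ) : Prop :=
  ∀ (a b : ℝ) (v : Fin k → V),
    ((α fun i => a • v i + b • J (v i) : ℝ) : ℂ) =
      ((a : ℂ) + b * Complex.I) ^ p * ((a : ℂ) - b * Complex.I) ^ q * ((α v : ℝ) : ℂ)

/-! ### Homogeneous spaces with the standard metric and the canonical connection -/

/-- Smooth Lie groups are Lie groups for the smoothness exponent required by Mathlib's construction
of the Lie algebra. -/
instance : ENat.LEInfty (minSmoothness ℝ 3) := by
  rw [minSmoothness_of_isRCLikeNormedField]
  infer_instance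

section Homogeneous

variable {n m : ℕ}
  {G : Type*} [TopologicalSpace G] [ChartedSpace (EuclideanSpace ℝ (Fin n)) G] [Group G]
  [LieGroup (𝓡 n) ∞ G]
  {M : Type*} [TopologicalSpace M] [ChartedSpace (EuclideanSpace ℝ (Fin m)) M] [MulAction G M]

/-- `M`, with base point `o`, is the homogeneous manifold `G / K`, where `K` is the stabilizer of
`o` and is connected: the action is transitive and the orbit map `g ↦ g • o` (which is the
projection `G → G / K`) is a submersion. -/
structure IsHomogeneousSpace (n m : ℕ) (G : Type*) [TopologicalSpace G]
    [ChartedSpace (EuclideanSpace ℝ (Fin n)) G] [Group G] {M : Type*} [TopologicalSpace M]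
    [ChartedSpace (EuclideanSpace ℝ (Fin m)) M] [MulAction G M] (o : M) : Prop where
  transitive : ∀ x : M, ∃ g : G, g • o = x
  submersion : ∀ g : G, Function.Surjective (mfderiv (𝓡 n) (𝓡 m) (fun h : G => h • o) g)
  connected : IsConnected (MulAction.stabilizer G o : Set G)

/-- An invariant metric on the Lie algebra `𝔤` of `G`: an inner product for which all `ad X` are
skew. -/
structure InvariantMetric (n : ℕ) (G : Type*) [TopologicalSpace G]
    [ChartedSpace (EuclideanSpace ℝ (Fin n)) G] [Group G] [LieGroup (𝓡 n) ∞ G] where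
  form : LinearMap.BilinForm ℝ (GroupLieAlgebra (𝓡 n) G)
  symm : ∀ X Y, form X Y = form Y X
  pos : ∀ X, X ≠ 0 → 0 < form X X
  invariant : ∀ X Y Z : GroupLieAlgebra (𝓡 n) G, form ⁅X, Y⁆ Z = -form Y ⁅X, Z⁆

/-- The Lie algebra `𝔨` of the stabilizer of `o`, that is the kernel of the differential at the
identity of the orbit map of `o`. -/
def isotropyAlgebra (n m : ℕ) (G : Type*) [TopologicalSpace G]
    [ChartedSpace (EuclideanSpace ℝ (Fin n)) G] [Group G] {M : Type*} [TopologicalSpace M]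
    [ChartedSpace (EuclideanSpace ℝ (Fin m)) M] [MulAction G M] (o : M) :
    Submodule ℝ (GroupLieAlgebra (𝓡 n) G) :=
  LinearMap.ker (mfderiv (𝓡 n) (𝓡 m) (fun h : G => h • o) (1 : G)).toLinearMap

/-- The image in `T_{g • o} M` of an element `X` of `𝔤`: the value at `g` of the left-invariant
vector field of `X`, projected to `M`. Restricted to `𝔪 = 𝔨ᗮ` this is the frame of `M` at `g • o`
given by `g`. -/
def frame (o : M) (g : G) : GroupLieAlgebra (𝓡 n) G →ₗ[ℝ] TangentSpace (𝓡 m) (g • o) where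
  toFun X := mfderiv (𝓡 n) (𝓡 m) (fun h : G => h • o) g (mulInvariantVectorField X g)
  map_add' X Y := by rw [mulInvariantVectorField_add, Pi.add_apply, map_add]
  map_smul' c X := by
    rw [mulInvariantVectorField_smul, Pi.smul_apply, map_smul, RingHom.id_apply]

namespace InvariantMetric

variable (B : InvariantMetric n G) (o : M)

/-- The orthogonal complement `𝔪 = 𝔨ᗮ`, identified with `T_o M`. -/
def complement : Submodule ℝ (GroupLieAlgebra (𝓡 n) G) :=
  B.form.orthogonal (isotropyAlgebra n m G o)

theorem isCompl : IsCompl (B.complement (m := m) o) (isotropyAlgebra n m G o) := by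
  have : FiniteDimensional ℝ (GroupLieAlgebra (𝓡 n) G) :=
    inferInstanceAs (FiniteDimensional ℝ (EuclideanSpace ℝ (Fin n)))
  have hr : B.form.IsRefl := fun X Y h => by rw [B.symm]; exact h
  refine ((LinearMap.BilinForm.isCompl_orthogonal_iff_disjoint hr).2 ?_).symm
  rw [Submodule.disjoint_def]
  intro X hX hX'
  by_contra hne
  exact (B.pos X hne).ne' (LinearMap.BilinForm.mem_orthogonal_iff.1 hX' X hX)

/-- The orthogonal projection `X ↦ X_𝔪` of `𝔤` onto `𝔪`. -/
def proj : GroupLieAlgebra (𝓡 n) G →ₗ[ℝ] B.complement (m := m) o :=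
  (B.complement (m := m) o).projectionOnto (isotropyAlgebra n m G o) (B.isCompl o)

/-- The bracket `[X, Y]_𝔪` of two elements of `𝔪`. -/
def bracket (X Y : B.complement (m := m) o) : B.complement (m := m) o :=
  B.proj o ⁅(X : GroupLieAlgebra (𝓡 n) G), (Y : GroupLieAlgebra (𝓡 n) G)⁆

/-- The isotropy representation of `𝔨` on `𝔪`, `Z ↦ (X ↦ [Z, X]_𝔪)`. -/
def isotropy : isotropyAlgebra n m G o →ₗ[ℝ] Module.End ℝ (B.complement (m := m) o) where
  toFun Z :=
    { toFun := fun X => B.proj o ⁅(Z : GroupLieAlgebra (𝓡 n) G), (X : GroupLieAlgebra (𝓡 n) G)⁆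
      map_add' := fun X Y => by simp
      map_smul' := fun c X => by simp }
  map_add' Z W := by ext X; simp
  map_smul' c Z := by ext X; simp

/-- A form on `M`, read at `g • o` in the frame given by `g`, as a form on `𝔪`. -/
def read {k : ℕ} (α : FormField m k M) (g : G) : B.complement (m := m) o [⋀^Fin k]→ₗ[ℝ] ℝ :=
  (α (g • o)).toAlternatingMap.compLinearMap (frame o g ∘ₗ (B.complement (m := m) o).subtype)

/-- `H` is the torsion three-form of the canonical connection of `M` for the standard homogeneous
metric, i.e. the homogeneous form given by `H (X, Y, Z) = -B ([X, Y]_𝔪, Z)` on `𝔪`. -/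
structure IsTorsion (H : FormField m 3 M) : Prop where
  smooth : H.IsSmooth
  eq : ∀ (g : G) (X Y Z : B.complement (m := m) o),
    B.read o H g ![X, Y, Z] =
      -B.form (B.bracket o X Y : GroupLieAlgebra (𝓡 n) G) (Z : GroupLieAlgebra (𝓡 n) G)

end InvariantMetric

/-- A homogeneous QKT structure on `M = G / K` with respect to the standard homogeneous metric and
the canonical connection: endomorphisms `J 0`, `J 1`, `J 2` of `𝔪 = T_o M` that span a homogeneous
almost quaternionic structure. -/
structure HomogeneousQKT (B : InvariantMetric n G) (o : M) where
  J : Fin 3 → Module.End ℝ (B.complement (m := m) o)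
  /-- The relations of the imaginary quaternions. -/
  sq : ∀ r, J r * J r = -1
  mul : ∀ r, J r * J (r + 1) = J (r + 2)
  /-- The metric is tri-hermitian. -/
  hermitian : ∀ r (X Y : B.complement (m := m) o),
    B.form (J r X : GroupLieAlgebra (𝓡 n) G) (J r Y : GroupLieAlgebra (𝓡 n) G) =
      B.form (X : GroupLieAlgebra (𝓡 n) G) (Y : GroupLieAlgebra (𝓡 n) G)
  /-- The `Sp(1)`-component of the canonical connection. -/
  A : isotropyAlgebra n m G o →ₗ[ℝ] (Fin 3 → ℝ)
  /-- The canonical connection preserves the quaternionic structure: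
  `∇ J_r = -2 ∑_{s,t} ε_{rst} A_s J_t`. -/
  parallel : ∀ (Z : isotropyAlgebra n m G o) (r : Fin 3),
    B.isotropy o Z * J r - J r * B.isotropy o Z =
      (-2 : ℝ) • (A Z (r + 1) • J (r + 2) - A Z (r + 2) • J (r + 1))
  /-- The structure is quaternionic and not (locally) hyper-complex: `𝔨` has an `𝔰𝔭(1)`-part, which
  rotates the `J_r`. -/
  rotates : Function.Surjective A
  /-- The Nijenhuis tensors of the `J_r`, with respect to the covariant derivative of `A`,
  vanish. Equivalently the torsion has no `(3,0)` and `(0,3)` part. -/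
  nijenhuis : ∀ r (X Y : B.complement (m := m) o),
    B.bracket o (J r X) (J r Y) - B.bracket o X Y - J r (B.bracket o (J r X) Y)
      - J r (B.bracket o X (J r Y)) = 0

namespace HomogeneousQKT

variable {B : InvariantMetric n G} {o : M}

/-- The `𝔰𝔭(1)`-part of `𝔨`: the orthogonal complement in `𝔨` of the ideal of the elements that
commute with the `J_r`. -/
def spOnePart (S : HomogeneousQKT (m := m) B o) : Set (isotropyAlgebra n m G o) :=
  {Z | ∀ W : isotropyAlgebra n m G o, S.A W = 0 →
    B.form (Z : GroupLieAlgebra (𝓡 n) G) (W : GroupLieAlgebra (𝓡 n) G) = 0}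

end HomogeneousQKT

end Homogeneous

end

/-!
The proof is algebraic once two facts about the orbit map `g ↦ g • o` are available. First, the
isotropy algebra `𝔨` is closed under the bracket (`lie_mem_isotropyAlgebra`), because left-invariant
vector fields of elements of `𝔨` are vertical. Second, the torsion form pulls back to a
left-invariant form on the group, so that its exterior derivative at the base point is given by the
formula of Chevalley and Eilenberg (`d_frame`). With the invariance of `B` and the Jacobi identity,
`dH` becomes a multiple of the 4-form `B ([·, ·]_𝔨 ∧ [·, ·]_𝔨)` (`IsTorsion.read_d`), which does not
involve the `𝔪`-component of the bracket any more.

The isotropy representation is `ad Z = ∑ r, A r Z • J r + U Z` with `U Z` commuting with all `J r`,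
and `A` is, up to a factor, a homomorphism to `ℝ³` with the cross product. Hence the `𝔰𝔭(1)`-part
has a basis `E r` with `A (E r)` the standard basis, and by invariance this basis is orthogonal with
vectors of equal length. In terms of the 2-forms `F r = B (J r ·, ·)` and `u r = B (U (E r) ·, ·)`,
the 4-form above is a multiple of `∑ r, (F r + u r) ∧ (F r + u r)`, up to a 4-form that is
invariant under all `J r`. Since `dH` is of type `(2,2)`, it is invariant under each `J r`. This map
preserves all `u s` and changes the sign of `F s` for `s ≠ r`; comparing the three invariances gives
`F r ∧ u r = 0` for each `r`. The wedge product with the nondegenerate form `F r` is injective on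
2-forms in dimension greater than four, so `U (E r) = 0`
(`isotropy_eq_of_curvatureForm_invariant`). The remaining dimension different from four is zero,
where there is nothing to prove.

Finally, an element of `𝔨` that acts on `𝔪` as `J 0` makes `J 0` a derivation of the product
`[·, ·]_𝔪`. A complex structure can be a derivation only of the zero product, as `± 2 i` and `0`
are not among its eigenvalues (`eq_zero_of_derivation`). Thus the torsion vanishes.
-/

noncomputable section

/-! ### Linear algebra of hermitian and quaternion-hermitian structures -/

section LinearAlgebra

variable {V : Type*} [AddCommGroup V] [Module ℝ V]

/-- The value at `(w, x, y, z)` of the wedge product of two 2-forms. -/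
def wedge (α β : V → V → ℝ) (w x y z : V) : ℝ :=
  α w x * β y z + β w x * α y z - α w y * β x z - β w y * α x z + α w z * β x y + β w z * α x y

omit [AddCommGroup V] [Module ℝ V] in
theorem wedge_self (α : V → V → ℝ) (w x y z : V) :
    wedge α α w x y z = 2 * (α w x * α y z - α w y * α x z + α w z * α x y) := by
  rw [wedge]
  ring

/-- In a real inner product space of dimension greater than four, there is a non-zero vector that is
orthogonal to four given vectors. -/
theorem exists_ne_zero_orthogonal [FiniteDimensional ℝ V] (hV : 4 < Module.finrank ℝ V)
    (g : LinearMap.BilinForm ℝ V) (v : Fin 4 → V) : ∃ z ≠ 0, ∀ i, g (v i) z = 0 := by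
  have h : LinearMap.ker (LinearMap.pi fun i => g (v i)) ≠ ⊥ :=
    LinearMap.ker_ne_bot_of_finrank_lt (by simpa using hV)
  obtain ⟨z, hz, hz0⟩ := Submodule.exists_mem_ne_zero_of_ne_bot h
  exact ⟨z, hz0, fun i => congrFun (LinearMap.mem_ker.1 hz) i⟩

/-- The wedge product with the Kähler form `g (J ·, ·)` is injective on `J`-invariant 2-forms in
real dimension greater than four: for three `J`-orthogonal vectors the values of
`u (x, J x) / g (x, x)` are pairwise opposite, hence zero. -/
theorem eq_zero_of_wedge_eq_zero [FiniteDimensional ℝ V] (hV : 4 < Module.finrank ℝ V)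
    {g : LinearMap.BilinForm ℝ V} (pos : ∀ x, x ≠ 0 → 0 < g x x)
    {J : Module.End ℝ V} (sq : ∀ x, J (J x) = -x) (herm : ∀ x y, g (J x) (J y) = g x y)
    {u : LinearMap.BilinForm ℝ V} (hu : ∀ x y, u x y = -u y x) (huJ : ∀ x y, u (J x) (J y) = u x y)
    (h : ∀ w x y z, wedge (fun x y => g (J x) y) (fun x y => u x y) w x y z = 0) (x y : V) :
    u x y = 0 := by
  have skew : ∀ x y, g (J x) y = -g x (J y) := fun x y => by
    rw [← herm x (J y), sq, map_neg, neg_neg]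
  -- evaluate the wedge product at `(x, J x, y, J y)`
  have key : ∀ x y, g x y = 0 → g (J x) y = 0 → g x x * u y (J y) + g y y * u x (J x) = 0 := by
    intro x y h1 h2
    have := h x (J x) y (J y)
    simp only [wedge, herm, h1, h2, sq, map_neg, LinearMap.neg_apply] at this
    have h3 : g x (J y) = 0 := by rw [← neg_eq_zero, ← skew, h2]
    rw [h3] at this
    linarith
  have diag : ∀ x, u x (J x) = 0 := by
    intro x
    by_cases hx : x = 0
    · simp [hx]
    obtain ⟨y, hy, hy'⟩ := exists_ne_zero_orthogonal hV g ![x, J x, x, J x]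
    obtain ⟨z, hz, hz'⟩ := exists_ne_zero_orthogonal hV g ![x, J x, y, J y]
    have e1 := key x y (hy' 0) (hy' 1)
    have e2 := key x z (hz' 0) (hz' 1)
    have e3 := key y z (hz' 2) (hz' 3)
    have px := pos x hx
    have py := pos y hy
    have pz := pos z hz
    have : g y y * g z z * u x (J x) = 0 := by
      linear_combination (1 / 2 : ℝ) * (g z z * e1 + g y y * e2 - g x x * e3)
    simpa [py.ne', pz.ne'] using this
  have polar : ∀ x y, u x (J y) = 0 := by
    intro x y
    have h1 := diag (x + y)
    simp only [map_add, LinearMap.add_apply, diag] at h1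
    have h2 := huJ y (J x)
    rw [sq, map_neg, hu] at h2
    linarith
  have := polar x (J y)
  rwa [sq, map_neg, neg_eq_zero] at this

/-- If a complex structure `J` acts as a derivation of a bilinear product, then the product
vanishes, as `± 2 i` and `0` are not eigenvalues of `J`. -/
theorem eq_zero_of_derivation {J : Module.End ℝ V} (sq : ∀ x, J (J x) = -x) {b : V → V → V}
    (neg_left : ∀ x y, b (-x) y = -b x y) (neg_right : ∀ x y, b x (-y) = -b x y)
    (h : ∀ x y, J (b x y) = b (J x) y + b x (J y)) (x y : V) : b x y = 0 := by
  have key : ∀ x y, b x y = (2 : ℝ) • b (J x) (J y) := by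
    intro x y
    have := congrArg J (h x y)
    rw [sq, map_add, h, h, sq, sq, neg_left, neg_right] at this
    linear_combination (norm := module) this
  have h1 := key x y
  have h2 := key (J x) (J y)
  rw [sq, sq, neg_left, neg_right, neg_neg] at h2
  have : (3 : ℝ) • b x y = 0 := by
    linear_combination (norm := module) (-2 : ℝ) • h2 - h1
  simpa using this

theorem Fin.sum_rotate {W : Type*} [AddCommMonoid W] (r : Fin 3) (f : Fin 3 → W) :
    ∑ s, f s = f r + f (r + 1) + f (r + 2) := by
  rw [Fin.sum_univ_three]
  fin_cases r
  · rfl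
  · exact add_rotate (f 0) (f 1) (f 2)
  · exact (add_rotate (f 2) (f 0) (f 1)).symm

/-- A quaternion-hermitian structure: an inner product `g` and orthogonal endomorphisms
`J 0`, `J 1`, `J 2` with the relations of the imaginary quaternions. -/
structure IsQuaternionHermitian (g : LinearMap.BilinForm ℝ V) (J : Fin 3 → Module.End ℝ V) :
    Prop where
  symm : ∀ x y, g x y = g y x
  pos : ∀ x, x ≠ 0 → 0 < g x x
  sq : ∀ r, J r * J r = -1
  mul : ∀ r, J r * J (r + 1) = J (r + 2)
  hermitian : ∀ r x y, g (J r x) (J r y) = g x y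

namespace IsQuaternionHermitian

variable {g : LinearMap.BilinForm ℝ V} {J : Fin 3 → Module.End ℝ V}
  (h : IsQuaternionHermitian g J)
include h

theorem sq_apply (r : Fin 3) (x : V) : J r (J r x) = -x := LinearMap.congr_fun (h.sq r) x

theorem mul_add_two (r : Fin 3) : J r * J (r + 2) = -J (r + 1) := by
  rw [← h.mul r, ← mul_assoc, h.sq, neg_one_mul]

theorem add_one_mul (r : Fin 3) : J (r + 1) * J r = -J (r + 2) := by
  have := h.mul_add_two (r + 1)
  rwa [show r + 1 + 2 = r by omega, show r + 1 + 1 = r + 2 by omega] at this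

theorem add_two_mul (r : Fin 3) : J (r + 2) * J r = J (r + 1) := by
  have := h.mul (r + 2)
  rwa [show r + 2 + 1 = r by omega, show r + 2 + 2 = r + 1 by omega] at this

theorem skew (r : Fin 3) (x y : V) : g (J r x) y = -g x (J r y) := by
  rw [← h.hermitian r x (J r y), h.sq_apply, map_neg, neg_neg]

theorem self_right (r : Fin 3) (x : V) : g x (J r x) = 0 := by
  have := h.skew r x x
  rw [h.symm] at this
  linarith

theorem add_one_right (r : Fin 3) (x : V) : g (J r x) (J (r + 1) x) = 0 := by
  rw [h.skew, ← Module.End.mul_apply, h.mul, h.self_right, neg_zero]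

theorem add_two_right (r : Fin 3) (x : V) : g (J r x) (J (r + 2) x) = 0 := by
  rw [h.skew, ← Module.End.mul_apply, h.mul_add_two, LinearMap.neg_apply, map_neg, h.self_right,
    neg_zero, neg_zero]

/-- A quaternion-hermitian space of positive dimension has dimension at least four. -/
theorem four_le_finrank [FiniteDimensional ℝ V] [Nontrivial V] : 4 ≤ Module.finrank ℝ V := by
  obtain ⟨x, hx⟩ := exists_ne (0 : V)
  have hp := (h.pos x hx).ne'
  have hli : LinearIndependent ℝ ![x, J 0 x, J 1 x, J 2 x] := by
    rw [Fintype.linearIndependent_iff]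
    intro c hc
    simp only [Fin.sum_univ_four, Matrix.cons_val] at hc
    have h01 : g (J 0 x) (J 1 x) = 0 := h.add_one_right 0 x
    have h12 : g (J 1 x) (J 2 x) = 0 := h.add_one_right 1 x
    have h02 : g (J 0 x) (J 2 x) = 0 := h.add_two_right 0 x
    have e0 := congrArg (g x) hc
    have e1 := congrArg (g (J 0 x)) hc
    have e2 := congrArg (g (J 1 x)) hc
    have e3 := congrArg (g (J 2 x)) hc
    simp only [map_add, map_smul, map_zero, smul_eq_mul, h.self_right, h.symm _ x, h01, h12, h02,
      h.symm (J 1 x) (J 0 x), h.symm (J 2 x) (J 0 x), h.symm (J 2 x) (J 1 x), h.hermitian, mul_zero,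
      add_zero, zero_add, mul_eq_zero, hp, or_false] at e0 e1 e2 e3
    intro i
    fin_cases i <;> assumption
  simpa using hli.fintype_card_le_finrank

/-- `J (r + 1)` and `J (r + 2)` are linearly independent. -/
theorem eq_of_smul_add_smul_eq [Nontrivial V] {r : Fin 3} {a b c d : ℝ}
    (he : a • J (r + 1) + b • J (r + 2) = c • J (r + 1) + d • J (r + 2)) : a = c ∧ b = d := by
  obtain ⟨x, hx⟩ := exists_ne (0 : V)
  have hp := (h.pos x hx).ne'
  have h12 : g (J (r + 1) x) (J (r + 2) x) = 0 := by
    have := h.add_one_right (r + 1) x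
    rwa [show r + 1 + 1 = r + 2 by omega] at this
  have e := LinearMap.congr_fun he x
  have e1 := congrArg (g (J (r + 1) x)) e
  have e2 := congrArg (g (J (r + 2) x)) e
  simp only [LinearMap.add_apply, LinearMap.smul_apply, map_add, map_smul, smul_eq_mul, h12,
    h.symm (J (r + 2) x) (J (r + 1) x), h.hermitian, mul_zero, add_zero, zero_add] at e1 e2
  exact ⟨mul_right_cancel₀ hp e1, mul_right_cancel₀ hp e2⟩

/-- Endomorphisms that act on the span of the `J r` as rotations with infinitesimal generators `a`
and `b` have a commutator whose generator is twice the cross product of `a` and `b`. -/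
theorem eq_cross_of_commutator [Nontrivial V] {P Q : Module.End ℝ V} {a b c : Fin 3 → ℝ}
    (hP : ∀ r, P * J r - J r * P = (-2 : ℝ) • (a (r + 1) • J (r + 2) - a (r + 2) • J (r + 1)))
    (hQ : ∀ r, Q * J r - J r * Q = (-2 : ℝ) • (b (r + 1) • J (r + 2) - b (r + 2) • J (r + 1)))
    (hPQ : ∀ r, (P * Q - Q * P) * J r - J r * (P * Q - Q * P) =
      (-2 : ℝ) • (c (r + 1) • J (r + 2) - c (r + 2) • J (r + 1))) (r : Fin 3) :
    c (r + 2) = 2 * (a r * b (r + 1) - a (r + 1) * b r) := by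
  have hr : r + 1 + 1 = r + 2 ∧ r + 1 + 2 = r ∧ r + 2 + 1 = r ∧ r + 2 + 2 = r + 1 := by omega
  have hP1 := hP (r + 1)
  have hQ1 := hQ (r + 1)
  have hP2 := hP (r + 2)
  have hQ2 := hQ (r + 2)
  rw [hr.1, hr.2.1] at hP1 hQ1
  rw [hr.2.2.1, hr.2.2.2] at hP2 hQ2
  have e : (P * Q - Q * P) * J r - J r * (P * Q - Q * P) =
      (P * (Q * J r - J r * Q) - (Q * J r - J r * Q) * P)
        - (Q * (P * J r - J r * P) - (P * J r - J r * P) * Q) := by noncomm_ring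
  rw [hP r, hQ r, hPQ r] at e
  simp only [mul_sub, sub_mul, smul_mul_assoc, mul_smul_comm] at e
  have e' : (2 * c (r + 2)) • J (r + 1) + (-2 * c (r + 1)) • J (r + 2) =
      (4 * (a r * b (r + 1) - a (r + 1) * b r)) • J (r + 1) +
        (4 * (a r * b (r + 2) - a (r + 2) * b r)) • J (r + 2) := by
    linear_combination (norm := module) e + (-2 * b (r + 1)) • hP2 + (2 * b (r + 2)) • hP1
      + (2 * a (r + 1)) • hQ2 - (2 * a (r + 2)) • hQ1
  have := (h.eq_of_smul_add_smul_eq e').1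
  linarith

/-- Let `ω s = g (J s ·, ·) + u s` with 2-forms `u s` that are invariant under all `J r`. If the
sum of the squares `ω s ∧ ω s` is invariant under all `J r`, then the mixed terms
`g (J s ·, ·) ∧ u s` vanish, because `J r` changes the signs of `g (J s ·, ·)` for `s ≠ r`. -/
theorem wedge_eq_zero {u : Fin 3 → V → V → ℝ} (hu : ∀ r s x y, u s (J r x) (J r y) = u s x y)
    (hinv : ∀ r w x y z,
      ∑ s, wedge (fun x y => g (J s x) y + u s x y) (fun x y => g (J s x) y + u s x y)
        (J r w) (J r x) (J r y) (J r z) =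
      ∑ s, wedge (fun x y => g (J s x) y + u s x y) (fun x y => g (J s x) y + u s x y) w x y z)
    (s : Fin 3) (w x y z : V) : wedge (fun x y => g (J s x) y) (u s) w x y z = 0 := by
  have h1 : ∀ r x y, g (J (r + 1) (J r x)) (J r y) = -g (J (r + 1) x) y := by
    intro r x y
    rw [← Module.End.mul_apply, h.add_one_mul, ← h.hermitian r (J (r + 1) x) y,
      ← Module.End.mul_apply (J r), h.mul, LinearMap.neg_apply, map_neg, LinearMap.neg_apply]
  have h2 : ∀ r x y, g (J (r + 2) (J r x)) (J r y) = -g (J (r + 2) x) y := by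
    intro r x y
    rw [← Module.End.mul_apply, h.add_two_mul, ← h.hermitian r (J (r + 2) x) y,
      ← Module.End.mul_apply (J r), h.mul_add_two, LinearMap.neg_apply, map_neg,
      LinearMap.neg_apply, neg_neg]
  have key : ∀ r, wedge (fun x y => g (J (r + 1) x) y) (u (r + 1)) w x y z +
      wedge (fun x y => g (J (r + 2) x) y) (u (r + 2)) w x y z = 0 := by
    intro r
    have e := hinv r w x y z
    rw [Fin.sum_rotate r, Fin.sum_rotate r] at e
    simp only [wedge, hu, h1, h2, h.hermitian] at e ⊢
    linear_combination (-1 / 4 : ℝ) * e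
  have k0 := key 0
  have k1 := key 1
  have k2 := key 2
  simp only [show (0 : Fin 3) + 1 = 1 from rfl, show (0 : Fin 3) + 2 = 2 from rfl,
    show (1 : Fin 3) + 1 = 2 from rfl, show (1 : Fin 3) + 2 = 0 from rfl,
    show (2 : Fin 3) + 1 = 0 from rfl, show (2 : Fin 3) + 2 = 1 from rfl] at k0 k1 k2
  fin_cases s
  · change wedge (fun x y => g (J 0 x) y) (u 0) w x y z = 0
    linarith
  · change wedge (fun x y => g (J 1 x) y) (u 1) w x y z = 0
    linarith
  · change wedge (fun x y => g (J 2 x) y) (u 2) w x y z = 0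
    linarith

end IsQuaternionHermitian

end LinearAlgebra

/-! ### Left-invariant vector fields and the orbit map in charts -/

section Analysis

open Filter Topology VectorField Set

section VectorSpace

variable {E F : Type*} [NormedAddCommGroup E] [NormedSpace ℝ E] [NormedAddCommGroup F]
  [NormedSpace ℝ F]

/-- The Lie bracket of two vector fields in the kernel of the differential of a map is in the
kernel of this differential. -/
theorem fderiv_lieBracket_eq_zero {f : E → F} {V W : E → E} {x : E} (hf : ContDiffAt ℝ 2 f x)
    (hV : DifferentiableAt ℝ V x) (hW : DifferentiableAt ℝ W x)
    (hfV : ∀ᶠ y in 𝓝 x, fderiv ℝ f y (V y) = 0) (hfW : ∀ᶠ y in 𝓝 x, fderiv ℝ f y (W y) = 0) :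
    fderiv ℝ f x (lieBracket ℝ V W x) = 0 := by
  have hdf : DifferentiableAt ℝ (fderiv ℝ f) x :=
    (hf.fderiv_right (m := 1) (by norm_num)).differentiableAt one_ne_zero
  have hsymm : IsSymmSndFDerivAt ℝ f x := hf.isSymmSndFDerivAt (by simp)
  have aux : ∀ {U : E → E}, DifferentiableAt ℝ U x → (∀ᶠ y in 𝓝 x, fderiv ℝ f y (U y) = 0) →
      ∀ v, fderiv ℝ f x (fderiv ℝ U x v) = -fderiv ℝ (fderiv ℝ f) x v (U x) := by
    intro U hU h0 v
    have h1 : fderiv ℝ (fun y => fderiv ℝ f y (U y)) x = 0 := by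
      rw [EventuallyEq.fderiv_eq (f := fun _ => (0 : F)) h0]
      simp
    rw [fderiv_clm_apply hdf hU] at h1
    have := DFunLike.congr_fun h1 v
    simp only [add_apply, ContinuousLinearMap.comp_apply,
      ContinuousLinearMap.flip_apply, zero_apply] at this
    exact eq_neg_of_add_eq_zero_left this
  rw [lieBracket, map_sub, aux hW hfW, aux hV hfV, hsymm.eq]
  simp

end VectorSpace

variable {n m : ℕ}
  {G : Type*} [TopologicalSpace G] [ChartedSpace (EuclideanSpace ℝ (Fin n)) G] [Group G]
  [LieGroup (𝓡 n) ∞ G]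
  {M : Type*} [TopologicalSpace M] [ChartedSpace (EuclideanSpace ℝ (Fin m)) M]

/-- The left-invariant vector field of `X` in the preferred chart at the identity. -/
def invariantFieldInChart (X : GroupLieAlgebra (𝓡 n) G) :
    EuclideanSpace ℝ (Fin n) → EuclideanSpace ℝ (Fin n) :=
  mpullbackWithin 𝓘(ℝ, EuclideanSpace ℝ (Fin n)) (𝓡 n) (extChartAt (𝓡 n) (1 : G)).symm
    (mulInvariantVectorField X) (range (𝓡 n))

theorem differentiableAt_invariantFieldInChart (X : GroupLieAlgebra (𝓡 n) G) :
    DifferentiableAt ℝ (invariantFieldInChart X) (extChartAt (𝓡 n) (1 : G) 1) := by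
  have h := (mdifferentiableAt_mulInvariantVectorField X
    (g := (1 : G))).mdifferentiableWithinAt (s := univ)
  have := h.differentiableWithinAt_mpullbackWithin_vectorField
  rw [preimage_univ, univ_inter, ModelWithCorners.range_eq_univ] at this
  rw [invariantFieldInChart, ModelWithCorners.range_eq_univ]
  exact differentiableWithinAt_univ.1 this

omit [LieGroup (𝓡 n) ∞ G] in
theorem mulInvariantVectorField_one (X : GroupLieAlgebra (𝓡 n) G) :
    mulInvariantVectorField X (1 : G) = X := by
  have h : (fun g : G => 1 * g) = id := funext one_mul
  have : ∀ f : G → G, f = id → ∀ Y : EuclideanSpace ℝ (Fin n),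
      (mfderiv (𝓡 n) (𝓡 n) f 1 : EuclideanSpace ℝ (Fin n) → EuclideanSpace ℝ (Fin n)) Y = Y := by
    rintro _ rfl Y
    rw [mfderiv_id]
    rfl
  exact this _ h X

theorem mfderiv_symm_mfderiv_extChartAt {x y : M} [IsManifold (𝓡 m) ∞ M]
    (hy : y ∈ (extChartAt (𝓡 m) x).source) (v : TangentSpace (𝓡 m) y) :
    mfderiv 𝓘(ℝ, EuclideanSpace ℝ (Fin m)) (𝓡 m) (extChartAt (𝓡 m) x).symm
        (extChartAt (𝓡 m) x y)
      (mfderiv (𝓡 m) 𝓘(ℝ, EuclideanSpace ℝ (Fin m)) (extChartAt (𝓡 m) x) y v) = v := by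
  have : IsManifold (𝓡 m) 1 M := .of_le (n := ∞) (by norm_cast)
  have := mfderivWithin_extChartAt_symm_comp_mfderiv_extChartAt' hy
  rw [ModelWithCorners.range_eq_univ, mfderivWithin_univ] at this
  exact DFunLike.congr_fun this v

theorem invariantFieldInChart_extChartAt (X : GroupLieAlgebra (𝓡 n) G)
    {g : G} (hg : g ∈ (extChartAt (𝓡 n) (1 : G)).source) :
    invariantFieldInChart X (extChartAt (𝓡 n) (1 : G) g) =
      mfderiv (𝓡 n) 𝓘(ℝ, EuclideanSpace ℝ (Fin n)) (extChartAt (𝓡 n) (1 : G)) g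
        (mulInvariantVectorField X g) := by
  have : IsManifold (𝓡 n) ∞ G := inferInstance
  have h1 : IsManifold (𝓡 n) 1 G := .of_le (n := ∞) (by norm_cast)
  have hy := (extChartAt (𝓡 n) (1 : G)).map_source hg
  have inv := isInvertible_mfderivWithin_extChartAt_symm hy
  -- tangent spaces at equal points are compared through the model space
  have h2 : ∀ g' : G, g' = g → (mulInvariantVectorField X g' : EuclideanSpace ℝ (Fin n)) =
      mulInvariantVectorField X g := by rintro _ rfl; rfl
  rw [invariantFieldInChart, mpullbackWithin_apply]
  refine (inv.inverse_apply_eq).2 ?_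
  rw [ModelWithCorners.range_eq_univ, mfderivWithin_univ]
  refine (h2 _ ((extChartAt (𝓡 n) (1 : G)).left_inv hg)).trans ?_
  exact (mfderiv_symm_mfderiv_extChartAt hg _).symm

theorem lieBracket_invariantFieldInChart (X Y : GroupLieAlgebra (𝓡 n) G) :
    lieBracket ℝ (invariantFieldInChart X) (invariantFieldInChart Y)
      (extChartAt (𝓡 n) (1 : G) 1) = invariantFieldInChart ⁅X, Y⁆ (extChartAt (𝓡 n) (1 : G) 1) := by
  have h1 : IsManifold (𝓡 n) 1 G := .of_le (n := ∞) (by norm_cast)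
  have inv := isInvertible_mfderiv_extChartAt (I := 𝓡 n) (mem_extChartAt_source (I := 𝓡 n) (1 : G))
  rw [invariantFieldInChart_extChartAt _ (mem_extChartAt_source _), mulInvariantVectorField_one,
    GroupLieAlgebra.bracket_def, ← mlieBracketWithin_univ, mlieBracketWithin_apply,
    preimage_univ, univ_inter, ModelWithCorners.range_eq_univ]
  refine Eq.trans ?_ (inv.self_apply_inverse _).symm
  simp only [invariantFieldInChart, ModelWithCorners.range_eq_univ]
  exact congrFun lieBracketWithin_univ.symm _

variable [IsManifold (𝓡 m) ∞ M] [MulAction G M] [ContMDiffSMul (𝓡 n) (𝓡 m) ∞ G M] (o : M)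

omit [LieGroup (𝓡 n) ∞ G] [IsManifold (𝓡 m) ∞ M] in
variable (n m G) in
theorem contMDiff_orbit : ContMDiff (𝓡 n) (𝓡 m) ∞ (fun g : G => g • o) :=
  contMDiff_id.smul contMDiff_const

variable (n m G) in
/-- The orbit map `g ↦ g • o` in the preferred charts at `1` and `1 • o`. -/
def orbitInChart : EuclideanSpace ℝ (Fin n) → EuclideanSpace ℝ (Fin m) :=
  fun y => extChartAt (𝓡 m) ((1 : G) • o) ((extChartAt (𝓡 n) (1 : G)).symm y • o)

omit [LieGroup (𝓡 n) ∞ G] [IsManifold (𝓡 m) ∞ M] in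
theorem contDiffAt_orbitInChart :
    ContDiffAt ℝ ∞ (orbitInChart n m G o) (extChartAt (𝓡 n) (1 : G) 1) := by
  have h := (contMDiff_orbit n m G o).contMDiffAt (x := (1 : G))
  rw [contMDiffAt_iff] at h
  have := h.2
  rw [ModelWithCorners.range_eq_univ, contDiffWithinAt_univ] at this
  exact this

theorem fderiv_orbitInChart {g : G} (hg : g ∈ (extChartAt (𝓡 n) (1 : G)).source)
    (hgo : g • o ∈ (extChartAt (𝓡 m) ((1 : G) • o)).source) (X : GroupLieAlgebra (𝓡 n) G) :
    fderiv ℝ (orbitInChart n m G o) (extChartAt (𝓡 n) (1 : G) g)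
        (invariantFieldInChart X (extChartAt (𝓡 n) (1 : G) g)) =
      mfderiv (𝓡 m) 𝓘(ℝ, EuclideanSpace ℝ (Fin m)) (extChartAt (𝓡 m) ((1 : G) • o)) (g • o)
        (frame o g X) := by
  have hG : IsManifold (𝓡 n) ∞ G := inferInstance
  have h1 : IsManifold (𝓡 n) 1 G := .of_le (n := ∞) (by norm_cast)
  have h2 : IsManifold (𝓡 m) 1 M := .of_le (n := ∞) (by norm_cast)
  have hπ : ∀ h : G, MDifferentiableAt (𝓡 n) (𝓡 m) (fun g : G => g • o) h := fun h =>
    (contMDiff_orbit n m G o).mdifferentiableAt (by simp)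
  have hφ : MDifferentiableAt (𝓡 n) 𝓘(ℝ, EuclideanSpace ℝ (Fin n)) (extChartAt (𝓡 n) (1 : G)) g :=
    mdifferentiableAt_extChartAt (by rwa [← extChartAt_source (𝓡 n)])
  have hψ : MDifferentiableAt (𝓡 m) 𝓘(ℝ, EuclideanSpace ℝ (Fin m))
      (extChartAt (𝓡 m) ((1 : G) • o)) (g • o) :=
    mdifferentiableAt_extChartAt (by rwa [← extChartAt_source (𝓡 m)])
  have hinv := (extChartAt (𝓡 n) (1 : G)).left_inv hg
  have hf : MDifferentiableAt 𝓘(ℝ, EuclideanSpace ℝ (Fin n)) 𝓘(ℝ, EuclideanSpace ℝ (Fin m))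
      (orbitInChart n m G o) (extChartAt (𝓡 n) (1 : G) g) := by
    have hs : MDifferentiableAt 𝓘(ℝ, EuclideanSpace ℝ (Fin n)) (𝓡 n)
        (extChartAt (𝓡 n) (1 : G)).symm (extChartAt (𝓡 n) (1 : G) g) := by
      rw [← mdifferentiableWithinAt_univ, ← ModelWithCorners.range_eq_univ (𝓡 n)]
      exact mdifferentiableWithinAt_extChartAt_symm ((extChartAt (𝓡 n) (1 : G)).map_source hg)
    have h3 := (hπ _).comp (extChartAt (𝓡 n) (1 : G) g) hs
    refine MDifferentiableAt.comp (extChartAt (𝓡 n) (1 : G) g) ?_ h3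
    rw [hinv]
    exact hψ
  -- composing with the chart keeps the base points `g` and `g • o` instead of their images under
  -- the inverse charts
  have hcomp : (orbitInChart n m G o) ∘ (extChartAt (𝓡 n) (1 : G)) =ᶠ[𝓝 g]
      (extChartAt (𝓡 m) ((1 : G) • o)) ∘ (fun g : G => g • o) := by
    filter_upwards [extChartAt_source_mem_nhds' hg] with h hh
    simp only [Function.comp_apply, orbitInChart]
    rw [(extChartAt (𝓡 n) (1 : G)).left_inv hh]
  have key := hcomp.mfderiv_eq (I := 𝓡 n) (I' := 𝓘(ℝ, EuclideanSpace ℝ (Fin m)))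
  rw [mfderiv_comp g hf hφ, mfderiv_comp g hψ (hπ g), mfderiv_eq_fderiv] at key
  rw [invariantFieldInChart_extChartAt X hg]
  exact DFunLike.congr_fun key (mulInvariantVectorField X g)

omit [LieGroup (𝓡 n) ∞ G] [IsManifold (𝓡 m) ∞ M] in
variable (n m G) in
/-- Near the identity, the charts at `1` and at `1 • o` are defined. -/
theorem eventually_mem_source : ∀ᶠ y in 𝓝 (extChartAt (𝓡 n) (1 : G) 1),
    ∃ g ∈ (extChartAt (𝓡 n) (1 : G)).source,
      g • o ∈ (extChartAt (𝓡 m) ((1 : G) • o)).source ∧ y = extChartAt (𝓡 n) (1 : G) g := by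
  have h1 := extChartAt_target_mem_nhds (I := 𝓡 n) (1 : G)
  have h2 : ∀ᶠ y in 𝓝 (extChartAt (𝓡 n) (1 : G) 1), (extChartAt (𝓡 n) (1 : G)).symm y • o ∈
      (extChartAt (𝓡 m) ((1 : G) • o)).source := by
    have hc : ContinuousAt (fun y => (extChartAt (𝓡 n) (1 : G)).symm y • o)
        (extChartAt (𝓡 n) (1 : G) 1) :=
      ((contMDiff_orbit n m G o).continuous.continuousAt).comp (continuousAt_extChartAt_symm _)
    refine hc.eventually_mem (extChartAt_source_mem_nhds' ?_)
    rw [extChartAt_to_inv]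
    exact mem_extChartAt_source _
  filter_upwards [h1, h2] with y hy hy'
  exact ⟨_, (extChartAt (𝓡 n) (1 : G)).map_target hy, hy',
    ((extChartAt (𝓡 n) (1 : G)).right_inv hy).symm⟩

omit [IsManifold (𝓡 m) ∞ M] in
/-- The left-invariant vector field of an element of the isotropy algebra is vertical: the orbit map
intertwines left translations with the action. -/
theorem frame_eq_zero {Z : GroupLieAlgebra (𝓡 n) G} (hZ : Z ∈ isotropyAlgebra n m G o) (g : G) :
    frame (m := m) o g Z = 0 := by
  have hZ' : mfderiv (𝓡 n) (𝓡 m) (fun h : G => h • o) 1 Z = 0 := hZ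
  have hπ : ∀ h : G, MDifferentiableAt (𝓡 n) (𝓡 m) (fun g : G => g • o) h := fun h =>
    (contMDiff_orbit n m G o).mdifferentiableAt (by simp)
  have hL : MDifferentiableAt (𝓡 n) (𝓡 n) (g * ·) (1 : G) :=
    (contMDiff_mul_left (I := 𝓡 n) (n := ∞)).mdifferentiableAt (by simp)
  have hA : MDifferentiableAt (𝓡 m) (𝓡 m) (fun x : M => g • x) ((1 : G) • o) :=
    ((contMDiff_const (I' := 𝓡 n) (c := g)).smul contMDiff_id :
      ContMDiff (𝓡 m) (𝓡 m) ∞ fun x : M => g • x)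
      |>.mdifferentiableAt (by simp)
  have e : (fun h : G => h • o) ∘ (g * ·) = (fun x : M => g • x) ∘ (fun h : G => h • o) :=
    funext fun h => mul_smul g h o
  have h1 := mfderiv_comp (1 : G) (hπ _) hL
  rw [e, mfderiv_comp (1 : G) hA (hπ 1)] at h1
  have h2 := DFunLike.congr_fun h1 Z
  have h3 : ∀ g' : G, g' = g → ∀ v : EuclideanSpace ℝ (Fin n),
      (mfderiv (𝓡 n) (𝓡 m) (fun h : G => h • o) g v : EuclideanSpace ℝ (Fin m)) =
        mfderiv (𝓡 n) (𝓡 m) (fun h : G => h • o) g' v := by rintro _ rfl v; rfl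
  refine (h3 _ (mul_one g) _).trans (h2.symm.trans ?_)
  rw [ContinuousLinearMap.comp_apply, hZ', map_zero]
  rfl

/-- The isotropy algebra is closed under the bracket. -/
theorem lie_mem_isotropyAlgebra {Z W : GroupLieAlgebra (𝓡 n) G}
    (hZ : Z ∈ isotropyAlgebra n m G o) (hW : W ∈ isotropyAlgebra n m G o) :
    ⁅Z, W⁆ ∈ isotropyAlgebra n m G o := by
  have h2 : IsManifold (𝓡 m) 1 M := .of_le (n := ∞) (by norm_cast)
  have vert : ∀ {X : GroupLieAlgebra (𝓡 n) G}, X ∈ isotropyAlgebra n m G o →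
      ∀ᶠ y in 𝓝 (extChartAt (𝓡 n) (1 : G) 1),
        fderiv ℝ (orbitInChart n m G o) y (invariantFieldInChart X y) = 0 := by
    intro X hX
    filter_upwards [eventually_mem_source n m G o] with y ⟨g, hg, hgo, hy⟩
    rw [hy, fderiv_orbitInChart o hg hgo, frame_eq_zero o hX, map_zero]
    rfl
  have h := fderiv_lieBracket_eq_zero ((contDiffAt_orbitInChart o).of_le (by norm_cast))
    (differentiableAt_invariantFieldInChart Z) (differentiableAt_invariantFieldInChart W)
    (vert hZ) (vert hW)
  rw [lieBracket_invariantFieldInChart,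
    fderiv_orbitInChart o (mem_extChartAt_source _) (mem_extChartAt_source _)] at h
  have inv := isInvertible_mfderiv_extChartAt (I := 𝓡 m)
    (mem_extChartAt_source (I := 𝓡 m) ((1 : G) • o))
  have h3 := inv.inverse_apply_self (frame o 1 ⁅Z, W⁆)
  have h4 : frame (m := m) o (1 : G) ⁅Z, W⁆ = 0 := by
    rw [← h3]
    refine (congrArg _ h).trans (map_zero _)
  have h5 : mfderiv (𝓡 n) (𝓡 m) (fun h : G => h • o) 1
      (mulInvariantVectorField ⁅Z, W⁆ (1 : G)) = 0 := h4
  rwa [mulInvariantVectorField_one] at h5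

theorem inChart_extChartAt {k : ℕ} (α : FormField m k M) {x y : M}
    (hy : y ∈ (extChartAt (𝓡 m) x).source) (w : Fin k → TangentSpace (𝓡 m) y) :
    α.inChart x (extChartAt (𝓡 m) x y)
      (fun i => mfderiv (𝓡 m) 𝓘(ℝ, EuclideanSpace ℝ (Fin m)) (extChartAt (𝓡 m) x) y (w i)) =
      α y w := by
  have h1 : ∀ y' : M, y' = y → ∀ v : Fin k → EuclideanSpace ℝ (Fin m), α y' v = α y v := by
    rintro _ rfl v; rfl
  rw [FormField.inChart]
  refine (h1 _ ((extChartAt (𝓡 m) x).left_inv hy) _).trans ?_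
  exact congrArg (α y) (funext fun i => mfderiv_symm_mfderiv_extChartAt hy (w i))

/-- The formula of Chevalley and Eilenberg for the exterior derivative at the base point of a form
whose values on the frames `frame o g` do not depend on `g`: this is Cartan's formula for the
pull-back of the form to the group, evaluated on left-invariant vector fields. As in
`extDeriv_apply_vectorField`, the pair `(i, j)` with `i ≤ j` stands for the pair `i < j + 1`. -/
theorem d_frame {k : ℕ} {α : FormField m (k + 1) M} (hα : α.IsSmooth)
    (c : (Fin (k + 1) → GroupLieAlgebra (𝓡 n) G) → ℝ)
    (hc : ∀ (g : G) Y, α (g • o) (fun i => frame o g (Y i)) = c Y)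
    (X : Fin (k + 2) → GroupLieAlgebra (𝓡 n) G) :
    α.d ((1 : G) • o) (fun i => frame o 1 (X i)) =
      -∑ i : Fin (k + 1), ∑ j ≥ i, (-1 : ℝ) ^ (i + j : ℕ) *
        c (Matrix.vecCons ⁅X i.castSucc, X j.succ⁆ (j.removeNth (i.castSucc.removeNth X))) := by
  have h2 : IsManifold (𝓡 m) 1 M := .of_le (n := ∞) (by norm_cast)
  set f := orbitInChart n m G o with hf
  set y₀ := extChartAt (𝓡 n) (1 : G) 1 with hy₀
  have hfy : f y₀ = extChartAt (𝓡 m) ((1 : G) • o) ((1 : G) • o) := by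
    rw [hf, orbitInChart, hy₀, extChartAt_to_inv]
  have hsm : ContDiffAt ℝ ∞ (α.inChart ((1 : G) • o)) (f y₀) := by
    rw [hfy]
    exact (hα _).contDiffAt (extChartAt_target_mem_nhds _)
  have hfs : ContDiffAt ℝ ∞ f y₀ := contDiffAt_orbitInChart o
  have hω := hsm.differentiableAt (by simp)
  have hpull := extDeriv_pullback hω (hfs.of_le (m := 2) (by norm_cast)) (by simp)
  have hval : ∀ Y : Fin (k + 1) → GroupLieAlgebra (𝓡 n) G, ∀ᶠ y in 𝓝 y₀,
      ((α.inChart ((1 : G) • o) (f y)).compContinuousLinearMap (fderiv ℝ f y))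
        (fun i => invariantFieldInChart (Y i) y) = c Y := by
    intro Y
    filter_upwards [eventually_mem_source n m G o] with y ⟨g, hg, hgo, hy⟩
    have hfg : f y = extChartAt (𝓡 m) ((1 : G) • o) (g • o) := by
      rw [hf, orbitInChart, hy, (extChartAt (𝓡 n) (1 : G)).left_inv hg]
    rw [ContinuousAlternatingMap.compContinuousLinearMap_apply, hfg, ← hc g Y,
      ← inChart_extChartAt α hgo]
    refine congrArg _ (funext fun i => ?_)
    rw [Function.comp_apply, hy]
    exact fderiv_orbitInChart o hg hgo (Y i)
  have hdiff : DifferentiableAt ℝ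
      (fun y => (α.inChart ((1 : G) • o) (f y)).compContinuousLinearMap (fderiv ℝ f y)) y₀ :=
    DifferentiableAt.continuousAlternatingMapCompContinuousLinearMap
      (hω.comp y₀ (hfs.differentiableAt (by simp)))
      ((hfs.fderiv_right (m := 1) (by norm_cast)).differentiableAt one_ne_zero)
  have hcartan := extDeriv_apply_vectorField (V := fun i => invariantFieldInChart (X i)) hdiff
    (fun i => differentiableAt_invariantFieldInChart (X i))
  -- the first sum in Cartan's formula consists of derivatives of constant functions
  have hzero : ∀ i : Fin (k + 2), fderiv ℝ (fun y =>
      ((α.inChart ((1 : G) • o) (f y)).compContinuousLinearMap (fderiv ℝ f y))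
        (i.removeNth fun i => invariantFieldInChart (X i) y)) y₀ = 0 := by
    intro i
    exact (EventuallyEq.fderiv_eq (f := fun _ => c (i.removeNth X)) (hval (i.removeNth X))).trans
      (by simp)
  have hbr : ∀ (i j : Fin (k + 1)),
      ((α.inChart ((1 : G) • o) (f y₀)).compContinuousLinearMap (fderiv ℝ f y₀))
        (Matrix.vecCons (lieBracket ℝ (invariantFieldInChart (X i.castSucc))
          (invariantFieldInChart (X j.succ)) y₀)
          (j.removeNth (i.castSucc.removeNth fun i => invariantFieldInChart (X i) y₀))) =
      c (Matrix.vecCons ⁅X i.castSucc, X j.succ⁆ (j.removeNth (i.castSucc.removeNth X))) := by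
    intro i j
    rw [← (hval _).self_of_nhds, hy₀, lieBracket_invariantFieldInChart]
    refine congrArg _ (funext fun l => ?_)
    refine Fin.cases ?_ (fun l => ?_) l <;> rfl
  simp only [hzero, zero_apply, smul_zero, Finset.sum_const_zero, zero_sub] at hcartan
  rw [hpull] at hcartan
  refine Eq.trans ?_ (hcartan.trans ?_)
  · rw [ContinuousAlternatingMap.compContinuousLinearMap_apply, hfy]
    refine congrArg (extDeriv (α.inChart ((1 : G) • o))
      (extChartAt (𝓡 m) ((1 : G) • o) ((1 : G) • o))) (funext fun i => ?_)
    exact (fderiv_orbitInChart o (mem_extChartAt_source _) (mem_extChartAt_source _) (X i)).symm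
  · simp only [hbr, zsmul_eq_mul]
    push_cast
    rfl

omit [IsManifold (𝓡 m) ∞ M] [ContMDiffSMul (𝓡 n) (𝓡 m) ∞ G M] in
/-- The frames of `M` span the tangent spaces. -/
theorem frame_surjective (hM : IsHomogeneousSpace n m G o) (g : G) :
    Function.Surjective (frame (n := n) (m := m) o g) := by
  intro v
  obtain ⟨w, hw⟩ := hM.submersion g v
  have hL : ∀ a b : G, MDifferentiableAt (𝓡 n) (𝓡 n) (a * ·) b := fun a b =>
    (contMDiff_mul_left (I := 𝓡 n) (n := ∞)).mdifferentiableAt (by simp)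
  have h1 := mfderiv_comp g (hL g (g⁻¹ * g)) (hL g⁻¹ g)
  have h2 : (g * · : G → G) ∘ (g⁻¹ * ·) = id := funext fun h => mul_inv_cancel_left g h
  rw [h2, mfderiv_id] at h1
  have h3 : ∀ a : G, a = 1 → ∀ u : EuclideanSpace ℝ (Fin n),
      (mfderiv (𝓡 n) (𝓡 n) (g * ·) a u : EuclideanSpace ℝ (Fin n)) =
        mfderiv (𝓡 n) (𝓡 n) (g * ·) (1 : G) u := by rintro _ rfl u; rfl
  refine ⟨(mfderiv (𝓡 n) (𝓡 n) (g⁻¹ * ·) g w : EuclideanSpace ℝ (Fin n)), ?_⟩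
  rw [← hw]
  refine congrArg (mfderiv (𝓡 n) (𝓡 m) (fun h : G => h • o) g) ?_
  refine (h3 _ (inv_mul_cancel g) _).symm.trans ?_
  exact (DFunLike.congr_fun h1 w).symm

end Analysis

/-! ### The reductive decomposition of the Lie algebra -/

section Reductive

variable {n m : ℕ}
  {G : Type*} [TopologicalSpace G] [ChartedSpace (EuclideanSpace ℝ (Fin n)) G] [Group G]
  [LieGroup (𝓡 n) ∞ G]
  {M : Type*} [TopologicalSpace M] [ChartedSpace (EuclideanSpace ℝ (Fin m)) M] [MulAction G M]

namespace InvariantMetric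

variable (B : InvariantMetric n G) {o : M}

theorem eq_zero_of_form_self {X : GroupLieAlgebra (𝓡 n) G} (h : B.form X X = 0) : X = 0 := by
  by_contra hne
  exact (B.pos X hne).ne' h

theorem form_lie_rotate (X Y Z : GroupLieAlgebra (𝓡 n) G) :
    B.form ⁅X, Y⁆ Z = B.form X ⁅Y, Z⁆ := by
  rw [← lie_skew, map_neg, LinearMap.neg_apply, B.invariant, neg_neg]

theorem form_isotropy_complement {Z : GroupLieAlgebra (𝓡 n) G} (hZ : Z ∈ isotropyAlgebra n m G o)
    (X : B.complement (m := m) o) : B.form Z (X : GroupLieAlgebra (𝓡 n) G) = 0 :=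
  LinearMap.BilinForm.mem_orthogonal_iff.1 X.2 Z hZ

theorem proj_coe (X : B.complement (m := m) o) : B.proj o (X : GroupLieAlgebra (𝓡 n) G) = X :=
  Submodule.projectionOnto_apply_left (B.isCompl o) X

theorem proj_eq_zero {Z : GroupLieAlgebra (𝓡 n) G} (hZ : Z ∈ isotropyAlgebra n m G o) :
    B.proj (m := m) o Z = 0 :=
  (Submodule.projectionOnto_apply_eq_zero_iff (B.isCompl o)).2 hZ

variable (o) in
theorem sub_proj_mem (X : GroupLieAlgebra (𝓡 n) G) :
    X - (B.proj (m := m) o X : GroupLieAlgebra (𝓡 n) G) ∈ isotropyAlgebra n m G o := by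
  rw [← Submodule.projectionOnto_apply_eq_zero_iff (B.isCompl o)]
  change B.proj o _ = 0
  rw [map_sub, B.proj_coe, sub_self]

theorem form_proj (X : GroupLieAlgebra (𝓡 n) G) (Y : B.complement (m := m) o) :
    B.form (B.proj (m := m) o X : GroupLieAlgebra (𝓡 n) G) (Y : GroupLieAlgebra (𝓡 n) G) =
      B.form X (Y : GroupLieAlgebra (𝓡 n) G) := by
  have := B.form_isotropy_complement (B.sub_proj_mem (m := m) o X) Y
  rw [map_sub, LinearMap.sub_apply] at this
  linarith

variable (o) in
/-- The `𝔨`-component of the bracket of two elements of `𝔪`. -/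
def isotropyPart (X Y : B.complement (m := m) o) : isotropyAlgebra n m G o :=
  ⟨_, B.sub_proj_mem o ⁅(X : GroupLieAlgebra (𝓡 n) G), (Y : GroupLieAlgebra (𝓡 n) G)⁆⟩

variable (o) in
/-- The inner product on `𝔪`. -/
def complementForm : LinearMap.BilinForm ℝ (B.complement (m := m) o) :=
  B.form.restrict (B.complement o)

theorem complementForm_apply (X Y : B.complement (m := m) o) :
    B.complementForm o X Y =
      B.form (X : GroupLieAlgebra (𝓡 n) G) (Y : GroupLieAlgebra (𝓡 n) G) := rfl

theorem form_isotropyPart (X Y : B.complement (m := m) o) (Z : isotropyAlgebra n m G o) :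
    B.form (B.isotropyPart o X Y : GroupLieAlgebra (𝓡 n) G) (Z : GroupLieAlgebra (𝓡 n) G) =
      B.complementForm o (B.isotropy o Z X) Y := by
  rw [isotropyPart, map_sub, LinearMap.sub_apply, B.symm _ (Z : GroupLieAlgebra (𝓡 n) G),
    B.symm _ (Z : GroupLieAlgebra (𝓡 n) G), B.form_isotropy_complement Z.2, sub_zero,
    ← B.form_lie_rotate, complementForm_apply]
  exact (B.form_proj _ _).symm

/-- The curvature 4-form of the reductive decomposition, a multiple of
`B ([·, ·]_𝔨 ∧ [·, ·]_𝔨)`. -/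
def curvatureForm (W X Y Z : B.complement (m := m) o) : ℝ :=
  B.form (B.isotropyPart o W X : GroupLieAlgebra (𝓡 n) G) (B.isotropyPart o Y Z)
    - B.form (B.isotropyPart o W Y : GroupLieAlgebra (𝓡 n) G) (B.isotropyPart o X Z)
    + B.form (B.isotropyPart o W Z : GroupLieAlgebra (𝓡 n) G) (B.isotropyPart o X Y)

/-- By invariance of `B` and the Jacobi identity, the 4-forms built from the `𝔪`- and the
`𝔨`-components of the bracket are opposite. -/
theorem form_bracket_eq_neg_curvatureForm (W X Y Z : B.complement (m := m) o) :
    B.complementForm o (B.bracket o W X) (B.bracket o Y Z)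
      - B.complementForm o (B.bracket o W Y) (B.bracket o X Z)
      + B.complementForm o (B.bracket o W Z) (B.bracket o X Y) = -B.curvatureForm W X Y Z := by
  have split : ∀ a b c d : B.complement (m := m) o,
      B.form ⁅(a : GroupLieAlgebra (𝓡 n) G), (b : GroupLieAlgebra (𝓡 n) G)⁆
        ⁅(c : GroupLieAlgebra (𝓡 n) G), (d : GroupLieAlgebra (𝓡 n) G)⁆ =
      B.complementForm o (B.bracket o a b) (B.bracket o c d) +
        B.form (B.isotropyPart o a b : GroupLieAlgebra (𝓡 n) G) (B.isotropyPart o c d) := by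
    intro a b c d
    have e : ∀ a b : B.complement (m := m) o,
        ⁅(a : GroupLieAlgebra (𝓡 n) G), (b : GroupLieAlgebra (𝓡 n) G)⁆ =
          (B.bracket o a b : GroupLieAlgebra (𝓡 n) G) + B.isotropyPart o a b := fun a b => by
      simp [isotropyPart, bracket]
    rw [e a b, e c d]
    simp only [map_add, LinearMap.add_apply, complementForm_apply,
      B.form_isotropy_complement (B.isotropyPart o a b).2,
      B.symm (B.bracket o a b : GroupLieAlgebra (𝓡 n) G) (B.isotropyPart o c d),
      B.form_isotropy_complement (B.isotropyPart o c d).2]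
    ring
  have jac : B.form ⁅(W : GroupLieAlgebra (𝓡 n) G), (X : GroupLieAlgebra (𝓡 n) G)⁆
        ⁅(Y : GroupLieAlgebra (𝓡 n) G), (Z : GroupLieAlgebra (𝓡 n) G)⁆
      - B.form ⁅(W : GroupLieAlgebra (𝓡 n) G), (Y : GroupLieAlgebra (𝓡 n) G)⁆
        ⁅(X : GroupLieAlgebra (𝓡 n) G), (Z : GroupLieAlgebra (𝓡 n) G)⁆
      + B.form ⁅(W : GroupLieAlgebra (𝓡 n) G), (Z : GroupLieAlgebra (𝓡 n) G)⁆
        ⁅(X : GroupLieAlgebra (𝓡 n) G), (Y : GroupLieAlgebra (𝓡 n) G)⁆ = 0 := by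
    rw [form_lie_rotate, form_lie_rotate, form_lie_rotate, ← map_sub, ← map_add,
      leibniz_lie (X : GroupLieAlgebra (𝓡 n) G), ← lie_skew (Z : GroupLieAlgebra (𝓡 n) G) ⁅_, _⁆]
    simp
  rw [split, split, split] at jac
  rw [curvatureForm]
  linarith

variable [IsManifold (𝓡 m) ∞ M] [ContMDiffSMul (𝓡 n) (𝓡 m) ∞ G M]

theorem lie_mem_complement {Z : GroupLieAlgebra (𝓡 n) G} (hZ : Z ∈ isotropyAlgebra n m G o)
    (X : B.complement (m := m) o) :
    ⁅Z, (X : GroupLieAlgebra (𝓡 n) G)⁆ ∈ B.complement (m := m) o := by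
  refine LinearMap.BilinForm.mem_orthogonal_iff.2 fun W hW => ?_
  change B.form W _ = 0
  rw [← B.form_lie_rotate]
  exact B.form_isotropy_complement (lie_mem_isotropyAlgebra o hW hZ) X

theorem isotropy_coe (Z : isotropyAlgebra n m G o) (X : B.complement (m := m) o) :
    (B.isotropy o Z X : GroupLieAlgebra (𝓡 n) G) =
      ⁅(Z : GroupLieAlgebra (𝓡 n) G), (X : GroupLieAlgebra (𝓡 n) G)⁆ :=
  congrArg Subtype.val (B.proj_coe ⟨_, B.lie_mem_complement Z.2 X⟩)

theorem isotropy_skew (Z : isotropyAlgebra n m G o) (X Y : B.complement (m := m) o) :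
    B.complementForm o (B.isotropy o Z X) Y = -B.complementForm o X (B.isotropy o Z Y) := by
  rw [complementForm_apply, complementForm_apply, isotropy_coe, isotropy_coe, B.invariant]

theorem isotropy_lie (Z W : isotropyAlgebra n m G o) :
    B.isotropy o ⟨_, lie_mem_isotropyAlgebra o Z.2 W.2⟩ =
      B.isotropy o Z * B.isotropy o W - B.isotropy o W * B.isotropy o Z := by
  ext X
  rw [isotropy_coe]
  simp only [LinearMap.sub_apply, Module.End.mul_apply, Submodule.coe_sub, isotropy_coe]
  rw [lie_lie]

/-- The isotropy representation acts by derivations of the `𝔪`-component of the bracket. -/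
theorem isotropy_bracket (Z : isotropyAlgebra n m G o) (X Y : B.complement (m := m) o) :
    B.isotropy o Z (B.bracket o X Y) =
      B.bracket o (B.isotropy o Z X) Y + B.bracket o X (B.isotropy o Z Y) := by
  have h : B.proj (m := m) o ⁅(Z : GroupLieAlgebra (𝓡 n) G),
      (B.isotropyPart o X Y : GroupLieAlgebra (𝓡 n) G)⁆ = 0 :=
    B.proj_eq_zero (lie_mem_isotropyAlgebra o Z.2 (B.isotropyPart o X Y).2)
  rw [isotropyPart, lie_sub, map_sub, sub_eq_zero, leibniz_lie] at h
  simp only [bracket, isotropy_coe, ← map_add]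
  exact h.symm

end InvariantMetric

end Reductive

/-! ### The `𝔰𝔭(1)`-part of the isotropy algebra -/

section SpOne

variable {n m : ℕ}
  {G : Type*} [TopologicalSpace G] [ChartedSpace (EuclideanSpace ℝ (Fin n)) G] [Group G]
  [LieGroup (𝓡 n) ∞ G]
  {M : Type*} [TopologicalSpace M] [ChartedSpace (EuclideanSpace ℝ (Fin m)) M] [MulAction G M]

namespace HomogeneousQKT

variable {B : InvariantMetric n G} {o : M} (S : HomogeneousQKT (m := m) B o)

theorem isQuaternionHermitian : IsQuaternionHermitian (B.complementForm o) S.J where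
  symm _ _ := B.symm _ _
  pos _ hX := B.pos _ fun h => hX (Subtype.ext h)
  sq := S.sq
  mul := S.mul
  hermitian := S.hermitian

/-- The part of the isotropy representation that commutes with the `J r`: the difference of the
isotropy representation and its `𝔰𝔭(1)`-component `Z ↦ ∑ r, A r Z • J r`. -/
def commutantPart : isotropyAlgebra n m G o →ₗ[ℝ] Module.End ℝ (B.complement (m := m) o) :=
  B.isotropy o - ∑ r, (LinearMap.proj r ∘ₗ S.A).smulRight (S.J r)

theorem isotropy_eq_add (Z : isotropyAlgebra n m G o) :
    B.isotropy o Z = ∑ r, S.A Z r • S.J r + S.commutantPart Z := by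
  simp [commutantPart]

theorem commutantPart_mul (Z : isotropyAlgebra n m G o) (r : Fin 3) :
    S.commutantPart Z * S.J r = S.J r * S.commutantPart Z := by
  have h := S.isQuaternionHermitian
  have hp := S.parallel Z r
  rw [S.isotropy_eq_add, Fin.sum_rotate r] at hp
  simp only [add_mul, mul_add, smul_mul_assoc, mul_smul_comm, h.add_one_mul, h.add_two_mul, h.mul,
    h.mul_add_two] at hp
  linear_combination (norm := module) hp

theorem commutantPart_apply_J (Z : isotropyAlgebra n m G o) (r : Fin 3)
    (X : B.complement (m := m) o) :
    S.commutantPart Z (S.J r X) = S.J r (S.commutantPart Z X) :=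
  LinearMap.congr_fun (S.commutantPart_mul Z r) X

theorem eq_zero_of_mem_spOnePart {Z : isotropyAlgebra n m G o} (hZ : Z ∈ S.spOnePart)
    (hA : S.A Z = 0) : Z = 0 :=
  Subtype.ext (B.eq_zero_of_form_self (hZ Z hA))

theorem sub_mem_spOnePart {Z W : isotropyAlgebra n m G o} (hZ : Z ∈ S.spOnePart)
    (hW : W ∈ S.spOnePart) : Z - W ∈ S.spOnePart := fun V hV => by
  rw [Submodule.coe_sub, map_sub, LinearMap.sub_apply, hZ V hV, hW V hV, sub_zero]

theorem sum_smul_mem_spOnePart {Z : Fin 3 → isotropyAlgebra n m G o} (hZ : ∀ r, Z r ∈ S.spOnePart)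
    (c : Fin 3 → ℝ) : ∑ r, c r • Z r ∈ S.spOnePart := fun V hV => by
  simp [hZ _ V hV]

theorem eq_of_mem_spOnePart {Z W : isotropyAlgebra n m G o} (hZ : Z ∈ S.spOnePart)
    (hW : W ∈ S.spOnePart) (hA : S.A Z = S.A W) : Z = W :=
  sub_eq_zero.1 <| S.eq_zero_of_mem_spOnePart (S.sub_mem_spOnePart hZ hW)
    (by rw [map_sub, hA, sub_self])

/-- The restriction of `A` to the `𝔰𝔭(1)`-part is surjective. -/
theorem exists_mem_spOnePart (v : Fin 3 → ℝ) : ∃ Z ∈ S.spOnePart, S.A Z = v := by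
  have : FiniteDimensional ℝ (GroupLieAlgebra (𝓡 n) G) :=
    inferInstanceAs (FiniteDimensional ℝ (EuclideanSpace ℝ (Fin n)))
  let b : LinearMap.BilinForm ℝ (isotropyAlgebra n m G o) := B.form.restrict _
  have hr : b.IsRefl := fun X Y h => (B.symm _ _).trans h
  have hc : IsCompl (LinearMap.ker S.A) (b.orthogonal (LinearMap.ker S.A)) := by
    refine (LinearMap.BilinForm.isCompl_orthogonal_iff_disjoint hr).2 ?_
    rw [Submodule.disjoint_def]
    intro X hX hX'
    exact Subtype.ext (B.eq_zero_of_form_self (LinearMap.BilinForm.mem_orthogonal_iff.1 hX' X hX))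
  obtain ⟨Z₀, hZ₀⟩ := S.rotates v
  obtain ⟨W, Z, hW, hZ, hWZ⟩ := Submodule.codisjoint_iff_exists_add_eq.1 hc.codisjoint Z₀
  refine ⟨Z, fun V hV => (B.symm _ _).trans (LinearMap.BilinForm.mem_orthogonal_iff.1 hZ V hV), ?_⟩
  rw [← hZ₀, ← hWZ, map_add, LinearMap.mem_ker.1 hW, zero_add]

variable [IsManifold (𝓡 m) ∞ M] [ContMDiffSMul (𝓡 n) (𝓡 m) ∞ G M]

/-- `2 • A` is a homomorphism of Lie algebras from `𝔨` to `ℝ³` with the cross product. -/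
theorem A_lie [Nontrivial (B.complement (m := m) o)] (Z W : isotropyAlgebra n m G o) (r : Fin 3) :
    S.A ⟨_, lie_mem_isotropyAlgebra o Z.2 W.2⟩ (r + 2) =
      2 * (S.A Z r * S.A W (r + 1) - S.A Z (r + 1) * S.A W r) := by
  have hp := S.parallel ⟨_, lie_mem_isotropyAlgebra o Z.2 W.2⟩
  rw [B.isotropy_lie] at hp
  exact S.isQuaternionHermitian.eq_cross_of_commutator (S.parallel Z) (S.parallel W) hp r

theorem lie_mem_spOnePart [Nontrivial (B.complement (m := m) o)] {Z W : isotropyAlgebra n m G o}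
    (hW : W ∈ S.spOnePart) :
    (⟨_, lie_mem_isotropyAlgebra o Z.2 W.2⟩ : isotropyAlgebra n m G o) ∈ S.spOnePart := by
  intro V hV
  change B.form ⁅(Z : GroupLieAlgebra (𝓡 n) G), (W : GroupLieAlgebra (𝓡 n) G)⁆ V = 0
  rw [B.invariant]
  have h : S.A ⟨_, lie_mem_isotropyAlgebra o Z.2 V.2⟩ = 0 := by
    ext t
    have := S.A_lie Z V (t + 1)
    rw [show t + 1 + 2 = t by omega, hV] at this
    simpa using this
  rw [hW ⟨_, lie_mem_isotropyAlgebra o Z.2 V.2⟩ h, neg_zero]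

/-- The `𝔰𝔭(1)`-part has a basis that `A` maps to the standard basis. By invariance, `B` is a
multiple of the standard inner product in this basis. -/
theorem exists_spOne_basis [Nontrivial (B.complement (m := m) o)] :
    ∃ (Z : Fin 3 → isotropyAlgebra n m G o) (l : ℝ), 0 < l ∧ (∀ r, Z r ∈ S.spOnePart) ∧
      (∀ r, S.A (Z r) = Pi.single r 1) ∧ ∀ r s,
        B.form (Z r : GroupLieAlgebra (𝓡 n) G) (Z s) = if r = s then l else 0 := by
  choose Z hZ hA using fun r : Fin 3 => S.exists_mem_spOnePart (Pi.single r 1)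
  have hlie : ∀ r, ⁅(Z r : GroupLieAlgebra (𝓡 n) G), (Z (r + 1) : GroupLieAlgebra (𝓡 n) G)⁆ =
      (2 : ℝ) • (Z (r + 2) : GroupLieAlgebra (𝓡 n) G) := by
    intro r
    refine congrArg Subtype.val (S.eq_of_mem_spOnePart (S.lie_mem_spOnePart (Z := Z r) (hZ (r + 1)))
      (W := (2 : ℝ) • Z (r + 2)) ?_ ?_)
    · intro V hV
      rw [Submodule.coe_smul, map_smul, LinearMap.smul_apply, hZ _ V hV, smul_zero]
    · ext t
      have := S.A_lie (Z r) (Z (r + 1)) (t + 1)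
      rw [show t + 1 + 2 = t by omega, hA, hA] at this
      rw [this, map_smul, hA]
      fin_cases r <;> fin_cases t <;> simp
  have hoff : ∀ r, B.form (Z (r + 2) : GroupLieAlgebra (𝓡 n) G) (Z (r + 1)) = 0 := by
    intro r
    have := B.form_lie_rotate (Z r : GroupLieAlgebra (𝓡 n) G) (Z (r + 1)) (Z (r + 1))
    rw [hlie, lie_self, map_zero, map_smul, LinearMap.smul_apply] at this
    simpa using this
  have hdiag : ∀ r, B.form (Z (r + 2) : GroupLieAlgebra (𝓡 n) G) (Z (r + 2)) =
      B.form (Z r : GroupLieAlgebra (𝓡 n) G) (Z r) := by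
    intro r
    have := B.form_lie_rotate (Z r : GroupLieAlgebra (𝓡 n) G) (Z (r + 1)) (Z (r + 2))
    have h2 := hlie (r + 1)
    rw [show r + 1 + 1 = r + 2 by omega, show r + 1 + 2 = r by omega] at h2
    rw [hlie, h2, map_smul, map_smul, LinearMap.smul_apply] at this
    simpa using this
  have d2 : B.form (Z 2 : GroupLieAlgebra (𝓡 n) G) (Z 2) =
    B.form (Z 0 : GroupLieAlgebra (𝓡 n) G) (Z 0) := hdiag 0
  have d1 : B.form (Z 1 : GroupLieAlgebra (𝓡 n) G) (Z 1) =
    B.form (Z 2 : GroupLieAlgebra (𝓡 n) G) (Z 2) := hdiag 2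
  have o21 : B.form (Z 2 : GroupLieAlgebra (𝓡 n) G) (Z 1) = 0 := hoff 0
  have o02 : B.form (Z 0 : GroupLieAlgebra (𝓡 n) G) (Z 2) = 0 := hoff 1
  have o10 : B.form (Z 1 : GroupLieAlgebra (𝓡 n) G) (Z 0) = 0 := hoff 2
  refine ⟨Z, B.form (Z 0 : GroupLieAlgebra (𝓡 n) G) (Z 0), B.pos _ fun h => ?_, hZ, hA, ?_⟩
  · have h0 : Z 0 = 0 := Subtype.ext h
    have := congrFun (hA 0) 0
    rw [h0, map_zero] at this
    simp at this
  · intro r s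
    fin_cases r <;> fin_cases s <;> simp [d1, d2, o21, o02, o10, B.symm (Z 1) (Z 2),
      B.symm (Z 2) (Z 0), B.symm (Z 0) (Z 1)]

end HomogeneousQKT

end SpOne

/-! ### The curvature form and the isotropy representation of the `𝔰𝔭(1)`-part -/

section Curvature

variable {n m : ℕ}
  {G : Type*} [TopologicalSpace G] [ChartedSpace (EuclideanSpace ℝ (Fin n)) G] [Group G]
  [LieGroup (𝓡 n) ∞ G]
  {M : Type*} [TopologicalSpace M] [ChartedSpace (EuclideanSpace ℝ (Fin m)) M] [MulAction G M]
  [IsManifold (𝓡 m) ∞ M] [ContMDiffSMul (𝓡 n) (𝓡 m) ∞ G M]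

namespace HomogeneousQKT

variable {B : InvariantMetric n G} {o : M} (S : HomogeneousQKT (m := m) B o)

theorem complementForm_commutantPart_skew (Z : isotropyAlgebra n m G o)
    (X Y : B.complement (m := m) o) :
    B.complementForm o (S.commutantPart Z X) Y = -B.complementForm o X (S.commutantPart Z Y) := by
  have h := B.isotropy_skew Z X Y
  simp only [S.isotropy_eq_add, LinearMap.add_apply, LinearMap.sum_apply, LinearMap.smul_apply,
    map_add, map_sum, map_smul, S.isQuaternionHermitian.skew, smul_neg, Finset.sum_neg_distrib] at h
  linarith

omit [IsManifold (𝓡 m) ∞ M] [ContMDiffSMul (𝓡 n) (𝓡 m) ∞ G M] in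
theorem complementForm_commutantPart_J (Z : isotropyAlgebra n m G o) (r : Fin 3)
    (X Y : B.complement (m := m) o) :
    B.complementForm o (S.commutantPart Z (S.J r X)) (S.J r Y) =
      B.complementForm o (S.commutantPart Z X) Y := by
  rw [commutantPart_apply_J, S.isQuaternionHermitian.hermitian]

/-- If the curvature 4-form is invariant under the `J r`, then in dimension greater than four the
`𝔰𝔭(1)`-part acts on `𝔪` by linear combinations of the `J r`. For a basis `E r` as in
`exists_spOne_basis`, a multiple of the curvature 4-form is, up to a 4-form coming from the kernel
of `A` that is invariant under the `J r`, the sum of the squares of the 2-forms `B ([E r, ·], ·)`.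
-/
theorem isotropy_eq_of_curvatureForm_invariant
    (hdim : 4 < Module.finrank ℝ (B.complement (m := m) o))
    (hinv : ∀ r (w x y z : B.complement (m := m) o),
      B.curvatureForm (S.J r w) (S.J r x) (S.J r y) (S.J r z) = B.curvatureForm w x y z)
    {Z : isotropyAlgebra n m G o} (hZ : Z ∈ S.spOnePart) :
    B.isotropy o Z = ∑ r, S.A Z r • S.J r := by
  have hnt : Nontrivial (B.complement (m := m) o) :=
    Module.nontrivial_of_finrank_pos (R := ℝ) (by omega)
  have hfin : FiniteDimensional ℝ (B.complement (m := m) o) :=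
    Module.finite_of_finrank_pos (by omega)
  have hQ := S.isQuaternionHermitian
  obtain ⟨E, l, hl, hE, hA, hEE⟩ := S.exists_spOne_basis
  -- the component in the kernel of `A`
  let k (P : isotropyAlgebra n m G o) : isotropyAlgebra n m G o := P - ∑ r, S.A P r • E r
  have hAk : ∀ P, S.A (k P) = 0 := by
    intro P
    ext s
    simp [k, hA, Pi.single_apply]
  have hform : ∀ (P : isotropyAlgebra n m G o) (s : Fin 3),
      B.form (P : GroupLieAlgebra (𝓡 n) G) (E s) = l * S.A P s := by
    intro P s
    have h0 := hE s _ (hAk P)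
    rw [B.symm] at h0
    simp [k, hEE] at h0
    linarith
  have hdec : ∀ P Q : isotropyAlgebra n m G o, l * B.form (P : GroupLieAlgebra (𝓡 n) G) Q =
      l * B.form (k P : GroupLieAlgebra (𝓡 n) G) (k Q) +
        ∑ r, B.form (P : GroupLieAlgebra (𝓡 n) G) (E r) *
          B.form (Q : GroupLieAlgebra (𝓡 n) G) (E r) := by
    intro P Q
    have hQ' : (Q : GroupLieAlgebra (𝓡 n) G) =
        k Q + ∑ r, S.A Q r • (E r : GroupLieAlgebra (𝓡 n) G) := by
      simp [k]
    have h1 : B.form (k P : GroupLieAlgebra (𝓡 n) G) Q =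
        B.form (k P : GroupLieAlgebra (𝓡 n) G) (k Q) := by
      rw [hQ', map_add, map_sum]
      simp [hform, hAk]
    have h2 : B.form (P : GroupLieAlgebra (𝓡 n) G) Q =
        B.form (k P : GroupLieAlgebra (𝓡 n) G) Q +
          ∑ r, S.A P r * B.form (Q : GroupLieAlgebra (𝓡 n) G) (E r) := by
      simp [k, B.symm (Q : GroupLieAlgebra (𝓡 n) G)]
    rw [h2, h1, mul_add, Finset.mul_sum]
    simp only [hform, mul_assoc]
  -- the kernel of `A` commutes with the `J r`, hence contributes 2-forms of type `(1, 1)`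
  have hkJ : ∀ r x y, k (B.isotropyPart o (S.J r x) (S.J r y)) = k (B.isotropyPart o x y) := by
    intro r x y
    have h1 : ∀ (V : isotropyAlgebra n m G o), S.A V = 0 → ∀ x y,
        B.form (k (B.isotropyPart o x y) : GroupLieAlgebra (𝓡 n) G) V =
          B.complementForm o (S.commutantPart V x) y := by
      intro V hV x y
      have h2 : B.isotropy o V = S.commutantPart V := by simp [S.isotropy_eq_add, hV]
      rw [← h2, ← B.form_isotropyPart]
      simp [k, fun r => hE r V hV]
    rw [← sub_eq_zero]
    refine Subtype.ext (B.eq_zero_of_form_self ?_)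
    have hV : S.A (k (B.isotropyPart o (S.J r x) (S.J r y)) - k (B.isotropyPart o x y)) = 0 := by
      rw [map_sub, hAk, hAk, sub_self]
    have h2 := h1 _ hV (S.J r x) (S.J r y)
    rw [complementForm_commutantPart_J, ← h1 _ hV, ← sub_eq_zero, ← LinearMap.sub_apply,
      ← map_sub] at h2
    exact h2
  let φ (r : Fin 3) (x y : B.complement (m := m) o) : ℝ :=
    B.complementForm o (S.J r x) y + B.complementForm o (S.commutantPart (E r) x) y
  have hφ : ∀ r x y, B.form (B.isotropyPart o x y : GroupLieAlgebra (𝓡 n) G) (E r) =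
      φ r x y := by
    intro r x y
    change _ = B.complementForm o (S.J r x) y + B.complementForm o (S.commutantPart (E r) x) y
    rw [B.form_isotropyPart, S.isotropy_eq_add, hA]
    simp [Pi.single_apply, ite_smul]
  -- as `E` is orthogonal with vectors of square length `l`, the remaining part of the curvature
  -- form is a sum of squares
  have hcurv : ∀ w x y z, l * B.curvatureForm w x y z =
      l * (B.form (k (B.isotropyPart o w x) : GroupLieAlgebra (𝓡 n) G) (k (B.isotropyPart o y z))
        - B.form (k (B.isotropyPart o w y) : GroupLieAlgebra (𝓡 n) G) (k (B.isotropyPart o x z))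
        + B.form (k (B.isotropyPart o w z) : GroupLieAlgebra (𝓡 n) G) (k (B.isotropyPart o x y)))
      + 1 / 2 * ∑ r, wedge (φ r) (φ r) w x y z := by
    intro w x y z
    simp only [wedge_self]
    rw [InvariantMetric.curvatureForm, mul_add, mul_sub, hdec, hdec (B.isotropyPart o w y),
      hdec (B.isotropyPart o w z), ← Finset.mul_sum, Finset.sum_add_distrib,
      Finset.sum_sub_distrib]
    simp only [hφ]
    ring
  have hwedge := hQ.wedge_eq_zero
    (u := fun s x y => B.complementForm o (S.commutantPart (E s) x) y)
    (fun r s x y => S.complementForm_commutantPart_J (E s) r x y) (by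
      intro r w x y z
      have h' := congrArg (l * ·) (hinv r w x y z)
      simp only [hcurv, hkJ] at h'
      change ∑ s, wedge (φ s) (φ s) _ _ _ _ = ∑ s, wedge (φ s) (φ s) _ _ _ _
      linarith only [h'])
  have hU : ∀ s, S.commutantPart (E s) = 0 := by
    intro s
    have h0 := eq_zero_of_wedge_eq_zero hdim hQ.pos (hQ.sq_apply s) (hQ.hermitian s)
      (u := B.complementForm o ∘ₗ S.commutantPart (E s))
      (fun x y => (S.complementForm_commutantPart_skew _ x y).trans
        (congrArg _ (hQ.symm _ _)))
      (S.complementForm_commutantPart_J (E s) s) (hwedge s)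
    ext x : 1
    by_contra hne
    exact (hQ.pos _ hne).ne' (h0 x _)
  have hZE : Z = ∑ r, S.A Z r • E r := by
    refine S.eq_of_mem_spOnePart hZ (S.sum_smul_mem_spOnePart hE _) ?_
    ext s
    simp [hA, Pi.single_apply]
  have hUZ : S.commutantPart Z = 0 := by
    rw [hZE, map_sum]
    simp [hU]
  rw [S.isotropy_eq_add, hUZ, add_zero]

/-- If the `𝔰𝔭(1)`-part acts by the `J r`, then these act as derivations of the `𝔪`-component of the
bracket, which has to vanish. -/
theorem bracket_eq_zero (h : ∀ Z ∈ S.spOnePart, B.isotropy o Z = ∑ r, S.A Z r • S.J r)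
    (X Y : B.complement (m := m) o) : B.bracket o X Y = 0 := by
  obtain ⟨Z, hZ, hA⟩ := S.exists_mem_spOnePart (Pi.single 0 1)
  have hJ : B.isotropy o Z = S.J 0 := by
    rw [h Z hZ, hA]
    simp [Pi.single_apply, ite_smul]
  refine eq_zero_of_derivation (S.isQuaternionHermitian.sq_apply 0) (b := B.bracket o) ?_ ?_
    (fun X Y => ?_) X Y
  · intro X Y
    simp only [InvariantMetric.bracket, Submodule.coe_neg, neg_lie, map_neg]
  · intro X Y
    simp only [InvariantMetric.bracket, Submodule.coe_neg, lie_neg, map_neg]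
  · rw [← hJ]
    exact B.isotropy_bracket Z X Y

end HomogeneousQKT

end Curvature

/-! ### The torsion form and its exterior derivative -/

section Torsion

variable {n m : ℕ}
  {G : Type*} [TopologicalSpace G] [ChartedSpace (EuclideanSpace ℝ (Fin n)) G] [Group G]
  [LieGroup (𝓡 n) ∞ G]
  {M : Type*} [TopologicalSpace M] [ChartedSpace (EuclideanSpace ℝ (Fin m)) M] [MulAction G M]
  [IsManifold (𝓡 m) ∞ M] [ContMDiffSMul (𝓡 n) (𝓡 m) ∞ G M]

namespace InvariantMetric

variable (B : InvariantMetric n G) {o : M}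

omit [IsManifold (𝓡 m) ∞ M] [ContMDiffSMul (𝓡 n) (𝓡 m) ∞ G M] in
theorem finrank_complement (hM : IsHomogeneousSpace n m G o) :
    Module.finrank ℝ (B.complement (m := m) o) = m := by
  have hfin : FiniteDimensional ℝ (GroupLieAlgebra (𝓡 n) G) :=
    inferInstanceAs (FiniteDimensional ℝ (EuclideanSpace ℝ (Fin n)))
  let f := (mfderiv (𝓡 n) (𝓡 m) (fun h : G => h • o) (1 : G)).toLinearMap
  have h1 := Submodule.finrank_add_eq_of_isCompl (B.isCompl (m := m) o)
  have h2 : Module.finrank ℝ (LinearMap.range f) + Module.finrank ℝ (isotropyAlgebra n m G o) =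
    Module.finrank ℝ (GroupLieAlgebra (𝓡 n) G) := LinearMap.finrank_range_add_finrank_ker f
  have h3 : LinearMap.range f = ⊤ := LinearMap.range_eq_top.2 (hM.submersion 1)
  have h4 : Module.finrank ℝ (TangentSpace (𝓡 m) ((1 : G) • o)) = m :=
    finrank_euclideanSpace_fin (𝕜 := ℝ) (n := m)
  rw [h3, finrank_top, h4] at h2
  omega

omit [IsManifold (𝓡 m) ∞ M] in
theorem frame_proj (g : G) (X : GroupLieAlgebra (𝓡 n) G) :
    frame (m := m) o g (B.proj (m := m) o X : GroupLieAlgebra (𝓡 n) G) = frame o g X := by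
  have := frame_eq_zero o (B.sub_proj_mem (m := m) o X) g
  rw [map_sub, sub_eq_zero] at this
  exact this.symm

omit [IsManifold (𝓡 m) ∞ M] in
variable {B} in
theorem IsTorsion.frame_apply {H : FormField m 3 M} (hH : B.IsTorsion o H) (g : G)
    (Y : Fin 3 → GroupLieAlgebra (𝓡 n) G) :
    H (g • o) (fun i => frame o g (Y i)) =
      -B.complementForm o (B.bracket (m := m) o (B.proj o (Y 0)) (B.proj o (Y 1)))
        (B.proj o (Y 2)) := by
  rw [complementForm_apply, ← hH.eq g]
  refine congrArg (H (g • o)) (funext fun i => ?_)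
  rw [← B.frame_proj]
  fin_cases i <;> rfl

variable {B} in
/-- The exterior derivative of the torsion form is the curvature form, up to a factor. -/
theorem IsTorsion.read_d {H : FormField m 3 M} (hH : B.IsTorsion o H)
    (X : Fin 4 → B.complement (m := m) o) :
    B.read o H.d 1 X = -2 * B.curvatureForm (X 0) (X 1) (X 2) (X 3) := by
  let c (Y : Fin 3 → GroupLieAlgebra (𝓡 n) G) : ℝ :=
    -B.complementForm o (B.bracket (m := m) o (B.proj o (Y 0)) (B.proj o (Y 1))) (B.proj o (Y 2))
  have h := d_frame o hH.smooth c hH.frame_apply (fun i => (X i : GroupLieAlgebra (𝓡 n) G))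
  have hrew : ∀ a b c d : B.complement (m := m) o,
      B.complementForm o (B.bracket o (B.bracket o a b) c) d =
        B.complementForm o (B.bracket o a b) (B.bracket o c d) := by
    intro a b c d
    rw [complementForm_apply, bracket, B.form_proj, B.form_lie_rotate, B.symm,
      ← B.form_proj, B.symm]
    rfl
  have hval : ∀ (a b p q : B.complement (m := m) o) (R : Fin 2 → GroupLieAlgebra (𝓡 n) G),
      R 0 = p → R 1 = q →
      c (Matrix.vecCons ⁅(a : GroupLieAlgebra (𝓡 n) G), (b : GroupLieAlgebra (𝓡 n) G)⁆ R) =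
        -B.complementForm o (B.bracket o a b) (B.bracket o p q) := by
    intro a b p q R h0 h1
    change -B.complementForm o (B.bracket (m := m) o (B.bracket o a b) (B.proj o (R 0)))
      (B.proj o (R 1)) = _
    rw [h0, h1, proj_coe, proj_coe, hrew]
  have hsum : ∀ F : Fin 3 → Fin 3 → ℝ, ∑ i, ∑ j ≥ i, F i j =
      F 0 0 + F 0 1 + F 0 2 + F 1 1 + F 1 2 + F 2 2 := by
    intro F
    rw [Fin.sum_univ_three, show Finset.Ici (0 : Fin 3) = {0, 1, 2} by decide,
      show Finset.Ici (1 : Fin 3) = {1, 2} by decide, show Finset.Ici (2 : Fin 3) = {2} by decide]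
    simp
    ring
  have hs := B.form_bracket_eq_neg_curvatureForm (X 0) (X 1) (X 2) (X 3)
  have hsymm : ∀ a b : B.complement (m := m) o, B.complementForm o a b = B.complementForm o b a :=
    fun a b => B.symm _ _
  refine Eq.trans (Eq.trans rfl h) ?_
  rw [hsum, hval (X (Fin.castSucc 0)) (X (Fin.succ 0)) (X 2) (X 3) _ rfl rfl,
    hval (X (Fin.castSucc 0)) (X (Fin.succ 1)) (X 1) (X 3) _ rfl rfl,
    hval (X (Fin.castSucc 0)) (X (Fin.succ 2)) (X 1) (X 2) _ rfl rfl,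
    hval (X (Fin.castSucc 1)) (X (Fin.succ 1)) (X 0) (X 3) _ rfl rfl,
    hval (X (Fin.castSucc 1)) (X (Fin.succ 2)) (X 0) (X 2) _ rfl rfl,
    hval (X (Fin.castSucc 2)) (X (Fin.succ 2)) (X 0) (X 1) _ rfl rfl,
    show (Fin.castSucc 0 : Fin 4) = 0 from rfl, show (Fin.castSucc 1 : Fin 4) = 1 from rfl,
    show (Fin.castSucc 2 : Fin 4) = 2 from rfl, show (Fin.succ 0 : Fin 4) = 1 from rfl,
    show (Fin.succ 1 : Fin 4) = 2 from rfl, show (Fin.succ 2 : Fin 4) = 3 from rfl,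
    hsymm (B.bracket o (X 1) (X 2)), hsymm (B.bracket o (X 1) (X 3)),
    hsymm (B.bracket o (X 2) (X 3))]
  norm_num
  linarith

omit [IsManifold (𝓡 m) ∞ M] in
variable {B} in
/-- The torsion form vanishes with the `𝔪`-component of the bracket. -/
theorem IsTorsion.eq_zero (hM : IsHomogeneousSpace n m G o) {H : FormField m 3 M}
    (hH : B.IsTorsion o H) (hb : ∀ X Y : B.complement (m := m) o, B.bracket o X Y = 0) (x : M) :
    H x = 0 := by
  obtain ⟨g, rfl⟩ := hM.transitive x
  ext v
  choose Y hY using fun i => frame_surjective o hM g (v i)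
  have h := hH.frame_apply g Y
  simp only [hY, hb] at h
  simpa using h

end InvariantMetric

end Torsion

theorem theorem9 {n m : ℕ}
    {G : Type*} [TopologicalSpace G] [T2Space G] [CompactSpace G]
    [ChartedSpace (EuclideanSpace ℝ (Fin n)) G] [Group G] [LieGroup (𝓡 n) ∞ G]
    {M : Type*} [TopologicalSpace M] [T2Space M]
    [ChartedSpace (EuclideanSpace ℝ (Fin m)) M] [IsManifold (𝓡 m) ∞ M]
    [MulAction G M] [ContMDiffSMul (𝓡 n) (𝓡 m) ∞ G M]
    (o : M) (hM : IsHomogeneousSpace n m G o)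
    (B : InvariantMetric n G) (S : HomogeneousQKT (m := m) B o)
    (H : FormField m 3 M) (hH : B.IsTorsion o H)
    (h22 : ∀ (g : G) (r : Fin 3), IsOfType (S.J r) 2 2 (B.read o H.d g)) :
    ((∃ x, H x ≠ 0) → m = 4) ∧
    (m ≠ 4 →
      (∀ Z ∈ S.spOnePart, B.isotropy o Z = ∑ r, S.A Z r • S.J r) ∧ ∀ x, H x = 0) := by
  have main : m ≠ 4 →
      (∀ Z ∈ S.spOnePart, B.isotropy o Z = ∑ r, S.A Z r • S.J r) ∧ ∀ x, H x = 0 := by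
    intro hm
    have hrank := B.finrank_complement (m := m) hM
    have hZ : ∀ Z ∈ S.spOnePart, B.isotropy o Z = ∑ r, S.A Z r • S.J r := by
      intro Z hZ
      rcases subsingleton_or_nontrivial (B.complement (m := m) o) with hs | hnt
      · exact Subsingleton.elim _ _
      have hfin : FiniteDimensional ℝ (B.complement (m := m) o) := by
        have : FiniteDimensional ℝ (GroupLieAlgebra (𝓡 n) G) :=
          inferInstanceAs (FiniteDimensional ℝ (EuclideanSpace ℝ (Fin n)))
        infer_instance
      have h4 := S.isQuaternionHermitian.four_le_finrank
      refine S.isotropy_eq_of_curvatureForm_invariant (by omega) (fun r w x y z => ?_) hZ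
      -- only the invariance under `J r` itself is needed, that is, the case `a = 0`, `b = 1`
      have h := h22 1 r 0 1 ![w, x, y, z]
      rw [hH.read_d, hH.read_d] at h
      simpa using h
    exact ⟨hZ, fun x => hH.eq_zero hM (S.bracket_eq_zero hZ) x⟩
  exact ⟨fun ⟨x, hx⟩ => by_contra fun hm => hx ((main hm).2 x), main⟩
end
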